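/- **Setting.** Let $\Theta\subset\mathbb R^p$ be open, let $U$ be a random element with distribution $Q$, let $\ell(\theta;u)$ be a loss function and $g(\theta)=E[\ell(\theta;U)]$. For each $n$ let $U_1,\dots,U_n$ be i.i.d. with distribution $Q$, let $\mathcal L^n(\theta)=\frac1n\sum_{i=1}^n\ell(\theta;U_i)$, and let $x_0^n$ be a (possibly random) initial value. (For different $n$ these may live on different probability spaces.) Assume: * (A0) $x_0^n-x_0=o_P(n^{-1/2})$ for a fixed $x_0$. * (A1) $\ell(\cdot;u)$ is twice continuously differentiable on $\Theta$ for each $u$, and $\|\nabla\ell(\theta;u)-\nabla\ell(\vartheta;u)\|\le h_1(u)\|\theta-\vartheta\|$ for $\theta,\vartheta\in\Theta$, where $h_1(U)$, and $\nabla\ell(\theta_0;U)$ for some fixed $\theta_0\in\Theta$, have finite fourth moments. * (A2) On $\Theta$: $E[\ell(\theta;U)]=g(\theta)$, $E[\nabla\ell(\theta;U)]=\nabla g(\theta)$, $E[\mathbf H\ell(\theta;U)]=\mathbf Hg(\theta)$ ($\mathbf H$ is the Hessian); $g$ is twice continuously differentiable and strongly convex, with Lipschitz gradient. * (A3) The cross-covariances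 $\varsigma_{ij}(\theta,\vartheta)=\mathrm{Cov}[\partial_i\ell(\theta;U),\partial_j\ell(\vartheta;U)]$ are continuously differentiable and Lipschitz on $\Theta\times\Theta$, and the matrix $\varsigma(\theta,\theta)$ is positive definite for every $\theta\in\Theta$. * (A4) On a bounded set $\Theta_X\subset\Theta$, $\sqrt n\,[\nabla\mathcal L^n(\theta)-\nabla g(\theta)]$ converges weakly, uniformly over $\theta\in\Theta_X$, to a Gaussian process $\mathbf Z(\theta)$ with mean zero and auto-covariance $\varsigma(\theta,\vartheta)$. Fix $T>0$ and consider either of the following two cases, with step size $\delta>0$. *Plain gradient descent:* $x^n_k=x^n_{k-1}-\delta\nabla\mathcal L^n(x^n_{k-1})$; time step $h=\delta$; for a field $F(t,y)$ the associated initial value problem is $\dot Y+F(t,Y)=0$, $Y(0)=y_0$. *Nesterov's accelerated gradient descent:* $y_0^n=x_0^n$, $x^n_k=y^n_{k-1}-\delta\nabla\mathcal L^n(y^n_{k-1})$, $y^n_k=x^n_k+\frac{k-1}{k+2}(x^n_k-x^n_{k-1})$; time step $h=\sqrt\delta$; for a field $F(t,y)$ the associated initial value problem is $\ddot Y+\frac3t\dot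 Y+F(t,Y)=0$, $Y(0)=y_0$, $\dot Y(0)=0$, with $Y\in C^1([0,T])$. In either case let $x^n_\delta(t)=x^n_k$ for $kh\le t<(k+1)h$, and let $X$ be the solution on $[0,T]$ of the associated problem with $F(t,y)=\nabla g(y)$ and $y_0=x_0$; assume that $X(t)$ lies in the interior of $\Theta_X$ for $t\in[0,T]$. (Where an iterate is outside $\Theta$, $\nabla\mathcal L^n$ is read as $0$.) **Theorem.** (i) Let $X^n$ be, with probability tending to one as $n\to\infty$, a $\Theta$-valued solution on $[0,T]$ of the associated problem with $F(t,y)=\nabla\mathcal L^n(y)$ and $y_0=x_0^n$. Then, as $\delta\to0$ and $n\to\infty$ jointly, $$\sup_{t\in[0,T]}|x^n_\delta(t)-X^n(t)|=O_P\big(\delta^{1/2}|\log\delta|\big),$$ that is, for each $\varepsilon>0$ there are $M,\delta_0>0$ and $N$ such that $P\big(\sup_{t\le T}|x^n_\delta(t)-X^n(t)|>M\delta^{1/2}|\log\delta|\big)\le\varepsilon$ for all $\delta\in(0,\delta_0)$ and $n\ge N$. (ii) Almost surely the associated problem with the random field $F(t,v)=[\mathbf Hg(X(t))]\,v+\mathbf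 Z(X(t))$ and $y_0=0$ has a unique solution $V$ on $[0,T]$; and if $\delta\to0$ and $n\to\infty$ in such a way that $n\delta|\log\delta|^2\to0$, then $\sqrt n\,[x^n_\delta-X]$ converges weakly to $V$ in the Skorokhod space $D([0,T])$. -/

import Mathlib

open MeasureTheory ProbabilityTheory Filter Topology Set
open scoped NNReal ENNReal Gradient

noncomputable section

/-! ### The Skorokhod space -/

/-- Càdlàg functions on `[0, T]`: right-continuous everywhere, with left limits. -/
structure IsCadlag {T : ℝ} {E : Type*} [TopologicalSpace E] (f : Icc (0 : ℝ) T → E) : Prop where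
  right_continuous : ∀ t, ContinuousWithinAt f (Ici t) t
  left_limit : ∀ t, ∃ l, Tendsto f (𝓝[<] t) (𝓝 l)

/-- The space `D([0, T])` of càdlàg functions with values in `E`. -/
structure SkorokhodSpace (T : ℝ) (E : Type*) [TopologicalSpace E] where
  toFun : Icc (0 : ℝ) T → E
  isCadlag : IsCadlag toFun

namespace SkorokhodSpace

instance {T : ℝ} {E : Type*} [TopologicalSpace E] :
    CoeFun (SkorokhodSpace T E) fun _ => Icc (0 : ℝ) T → E := ⟨toFun⟩

/-- The cost of a time change `κ` (an increasing bijection of `[0, T]`, which is automatically a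
homeomorphism): the larger of `sup_t |κ t - t|` and `sup_t |f t - g (κ t)|`. -/
def cost {T : ℝ} {E : Type*} [PseudoEMetricSpace E] (f g : Icc (0 : ℝ) T → E)
    (κ : Icc (0 : ℝ) T ≃o Icc (0 : ℝ) T) : ℝ≥0∞ :=
  max (⨆ t, edist (κ t) t) (⨆ t, edist (f t) (g (κ t)))

theorem cost_symm {T : ℝ} {E : Type*} [PseudoEMetricSpace E] (f g : Icc (0 : ℝ) T → E)
    (κ : Icc (0 : ℝ) T ≃o Icc (0 : ℝ) T) : cost g f κ.symm ≤ cost f g κ := by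
  refine max_le_max (iSup_le fun t => ?_) (iSup_le fun t => ?_)
  · refine le_iSup_of_le (κ.symm t) ?_
    rw [OrderIso.apply_symm_apply, edist_comm]
  · refine le_iSup_of_le (κ.symm t) ?_
    rw [OrderIso.apply_symm_apply, edist_comm]

theorem cost_trans {T : ℝ} {E : Type*} [PseudoEMetricSpace E] (f g h : Icc (0 : ℝ) T → E)
    (κ ν : Icc (0 : ℝ) T ≃o Icc (0 : ℝ) T) :
    cost f h (κ.trans ν) ≤ cost f g κ + cost g h ν := by
  refine max_le (iSup_le fun t => ?_) (iSup_le fun t => ?_)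
  · calc edist (ν (κ t)) t ≤ edist (ν (κ t)) (κ t) + edist (κ t) t := edist_triangle _ _ _
      _ = edist (κ t) t + edist (ν (κ t)) (κ t) := add_comm _ _
      _ ≤ cost f g κ + cost g h ν := add_le_add
          (le_max_of_le_left (le_iSup (fun s => edist (κ s) s) t))
          (le_max_of_le_left (le_iSup (fun s => edist (ν s) s) (κ t)))
  · calc edist (f t) (h (ν (κ t)))
        ≤ edist (f t) (g (κ t)) + edist (g (κ t)) (h (ν (κ t))) := edist_triangle _ _ _
      _ ≤ cost f g κ + cost g h ν := add_le_add
          (le_max_of_le_right (le_iSup (fun s => edist (f s) (g (κ s))) t))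
          (le_max_of_le_right (le_iSup (fun s => edist (g s) (h (ν s))) (κ t)))

/-- The Skorokhod (J1) metric on `D([0, T])`: the infimum of the cost over all time changes. -/
instance {T : ℝ} {E : Type*} [PseudoEMetricSpace E] : PseudoEMetricSpace (SkorokhodSpace T E) where
  edist f g := ⨅ κ : Icc (0 : ℝ) T ≃o Icc (0 : ℝ) T, cost f g κ
  edist_self f := by
    refine le_antisymm (iInf_le_of_le (OrderIso.refl _) ?_) bot_le
    simp [cost]
  edist_comm f g := le_antisymm
    (le_iInf fun κ => iInf_le_of_le κ.symm (cost_symm g f κ))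
    (le_iInf fun κ => iInf_le_of_le κ.symm (cost_symm f g κ))
  edist_triangle f g h := by
    exact ENNReal.le_iInf_add_iInf fun κ ν =>
      iInf_le_of_le (κ.trans ν) (cost_trans f g h κ ν)

instance {T : ℝ} {E : Type*} [PseudoEMetricSpace E] : MeasurableSpace (SkorokhodSpace T E) :=
  borel _

instance {T : ℝ} {E : Type*} [PseudoEMetricSpace E] : BorelSpace (SkorokhodSpace T E) := ⟨rfl⟩

end SkorokhodSpace

theorem ContinuousMap.isCadlag {T : ℝ} {E : Type*} [TopologicalSpace E] (f : C(Icc (0 : ℝ) T, E)) :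
    IsCadlag f :=
  ⟨fun _ => f.continuous.continuousWithinAt,
    fun t => ⟨f t, f.continuous.continuousAt.tendsto.mono_left nhdsWithin_le_nhds⟩⟩

/-- A continuous path, seen as an element of `D([0, T])`. -/
def ContinuousMap.toSkorokhod {T : ℝ} {E : Type*} [TopologicalSpace E]
    (f : C(Icc (0 : ℝ) T, E)) : SkorokhodSpace T E := ⟨f, f.isCadlag⟩

/-! ### Step functions -/

/-- The step function of a sequence `x` with time step `h > 0`: its value is `x k` for
`k * h ≤ t < (k + 1) * h`. -/
def stepFun {E : Type*} (h : ℝ) (x : ℕ → E) (t : ℝ) : E := x ⌊t / h⌋₊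

theorem stepFun_eq {E : Type*} {h : ℝ} (hh : 0 < h) (x : ℕ → E) {t : ℝ} {k : ℕ}
    (h1 : k * h ≤ t) (h2 : t < (k + 1) * h) : stepFun h x t = x k := by
  have : ⌊t / h⌋₊ = k := by
    rw [Nat.floor_eq_iff (div_nonneg (le_trans (by positivity) h1) hh.le)]
    exact ⟨(le_div_iff₀ hh).2 h1, (div_lt_iff₀ hh).2 h2⟩
  rw [stepFun, this]

theorem eventually_floor_right {h : ℝ} (hh : 0 < h) (t : ℝ) :
    ∀ᶠ s in 𝓝[≥] t, ⌊s / h⌋₊ = ⌊t / h⌋₊ := by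
  have h1 : Tendsto (fun s : ℝ => s / h) (𝓝[≥] t) (𝓝[≥] (t / h)) := by
    refine tendsto_nhdsWithin_iff.2 ⟨?_, ?_⟩
    · exact (continuous_id.div_const h).continuousAt.tendsto.mono_left nhdsWithin_le_nhds
    · filter_upwards [self_mem_nhdsWithin] with s hs
      exact div_le_div_of_nonneg_right hs hh.le
  filter_upwards [tendsto_pure.1 ((tendsto_floor_right_pure_floor (t / h)).comp h1)] with s hs
  rw [← Int.floor_toNat, ← Int.floor_toNat]
  exact congrArg Int.toNat hs

theorem eventually_floor_left {h : ℝ} (hh : 0 < h) (t : ℝ) :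
    ∀ᶠ s in 𝓝[<] t, ⌊s / h⌋₊ = (⌈t / h⌉ - 1).toNat := by
  have h1 : Tendsto (fun s : ℝ => s / h) (𝓝[<] t) (𝓝[<] (t / h)) := by
    refine tendsto_nhdsWithin_iff.2 ⟨?_, ?_⟩
    · exact (continuous_id.div_const h).continuousAt.tendsto.mono_left nhdsWithin_le_nhds
    · filter_upwards [self_mem_nhdsWithin] with s hs
      exact div_lt_div_of_pos_right hs hh
  filter_upwards [tendsto_pure.1 ((tendsto_floor_left_pure_ceil_sub_one (t / h)).comp h1)]
    with s hs
  rw [← Int.floor_toNat]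
  exact congrArg Int.toNat hs

theorem isCadlag_stepFun {E : Type*} [TopologicalSpace E] {T : ℝ} (h : ℝ) (x : ℕ → E) :
    IsCadlag fun t : Icc (0 : ℝ) T => stepFun h x t := by
  rcases le_or_gt h 0 with hh | hh
  · have h0 : (fun t : Icc (0 : ℝ) T => stepFun h x t) = fun _ => x 0 := by
      funext t
      have : (t : ℝ) / h ≤ 0 := div_nonpos_of_nonneg_of_nonpos t.2.1 hh
      simp [stepFun, Nat.floor_of_nonpos this]
    rw [h0]
    exact ⟨fun t => continuousWithinAt_const, fun t => ⟨x 0, tendsto_const_nhds⟩⟩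
  · have hr : ∀ t : Icc (0 : ℝ) T, Tendsto (Subtype.val : Icc (0 : ℝ) T → ℝ) (𝓝[≥] t)
        (𝓝[≥] (t : ℝ)) := fun t => tendsto_nhdsWithin_iff.2
      ⟨continuous_subtype_val.continuousAt.tendsto.mono_left nhdsWithin_le_nhds, by
        filter_upwards [self_mem_nhdsWithin] with s hs using hs⟩
    have hl : ∀ t : Icc (0 : ℝ) T, Tendsto (Subtype.val : Icc (0 : ℝ) T → ℝ) (𝓝[<] t)
        (𝓝[<] (t : ℝ)) := fun t => tendsto_nhdsWithin_iff.2
      ⟨continuous_subtype_val.continuousAt.tendsto.mono_left nhdsWithin_le_nhds, by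
        filter_upwards [self_mem_nhdsWithin] with s hs using hs⟩
    refine ⟨fun t => ?_, fun t => ⟨x (⌈(t : ℝ) / h⌉ - 1).toNat, ?_⟩⟩
    · refine tendsto_const_nhds.congr' ?_
      filter_upwards [(hr t).eventually (eventually_floor_right hh t)] with s hs
      simp [stepFun, hs]
    · refine tendsto_const_nhds.congr' ?_
      filter_upwards [(hl t).eventually (eventually_floor_left hh t)] with s hs
      simp [stepFun, hs]

/-- The element `t ↦ c • (x_h(t) - X(t))` of `D([0, T])`, where `x_h` is the step function of the
sequence `x` with time step `h`, and `X` is a continuous path. -/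
def stepError {E : Type*} [NormedAddCommGroup E] [NormedSpace ℝ E] {T : ℝ} (c h : ℝ) (x : ℕ → E)
    (X : C(Icc (0 : ℝ) T, E)) : SkorokhodSpace T E where
  toFun t := c • (stepFun h x t - X t)
  isCadlag := ⟨fun t => (((isCadlag_stepFun h x).right_continuous t).sub
      (X.isCadlag.right_continuous t)).const_smul c, fun t => by
    obtain ⟨a, ha⟩ := (isCadlag_stepFun (T := T) h x).left_limit t
    obtain ⟨b, hb⟩ := X.isCadlag.left_limit t
    exact ⟨c • (a - b), (ha.sub hb).const_smul c⟩⟩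

/-! ### Weak convergence uniformly over a set -/

instance {α β : Type*} [UniformSpace β] : MeasurableSpace (UniformFun α β) := borel _

instance {α β : Type*} [UniformSpace β] : BorelSpace (UniformFun α β) := ⟨rfl⟩

/-- The restriction of `f` to `A`, as a point of the space of functions on `A` with the topology
of uniform convergence. -/
def restrictUniform {α β : Type*} (A : Set α) (f : α → β) : UniformFun A β :=
  UniformFun.ofFun (A.domRestrict f)

/-! ### Stochastic order symbols (the probability space may depend on the index) -/

/-- `R_i = O_P(r_i)` along `l`: for each `ε > 0` there is `M` such that eventually
`P_i(R_i > M r_i) ≤ ε`. -/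
def IsBigOP {ι : Type*} {Ω : ι → Type*} {mΩ : ∀ i, MeasurableSpace (Ω i)}
    (P : ∀ i, Measure (Ω i)) (l : Filter ι) (R : ∀ i, Ω i → ℝ≥0∞) (r : ι → ℝ) : Prop :=
  ∀ ε : ℝ, 0 < ε → ∃ M : ℝ, 0 < M ∧
    ∀ᶠ i in l, P i {ω | ENNReal.ofReal (M * r i) < R i ω} ≤ ENNReal.ofReal ε

/-- `R_i = o_P(r_i)` along `l`: for each `ε > 0`, `P_i(R_i > ε r_i)` tends to `0`. -/
def IsLittleOP {ι : Type*} {Ω : ι → Type*} {mΩ : ∀ i, MeasurableSpace (Ω i)}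
    (P : ∀ i, Measure (Ω i)) (l : Filter ι) (R : ∀ i, Ω i → ℝ≥0∞) (r : ι → ℝ) : Prop :=
  ∀ ε : ℝ, 0 < ε → Tendsto (fun i => P i {ω | ENNReal.ofReal (ε * r i) < R i ω}) l (𝓝 0)

/-! ### The two algorithms and their differential equations -/

/-- The plain and the Nesterov accelerated gradient descent. -/
inductive DescentMethod
  | plain
  | accelerated

/-- The plain iteration `x_{k+1} = x_k - δ F(x_k)`. -/
def plainIterate {E : Type*} [AddCommGroup E] [Module ℝ E] (F : E → E) (δ : ℝ) (x₀ : E) : ℕ → E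
  | 0 => x₀
  | k + 1 => plainIterate F δ x₀ k - δ • F (plainIterate F δ x₀ k)

/-- The pairs `(x_k, y_k)` of the accelerated iteration: `x_0 = y_0`, and for `k ≥ 1`,
`x_k = y_{k-1} - δ F(y_{k-1})`, `y_k = x_k + ((k - 1) / (k + 2)) (x_k - x_{k-1})`
(written below with `k + 1` in place of `k`). -/
def acceleratedIterate {E : Type*} [AddCommGroup E] [Module ℝ E] (F : E → E) (δ : ℝ) (x₀ : E) :
    ℕ → E × E
  | 0 => (x₀, x₀)
  | k + 1 =>
    let x := (acceleratedIterate F δ x₀ k).1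
    let y := (acceleratedIterate F δ x₀ k).2
    let x' := y - δ • F y
    (x', x' + ((((k + 1 : ℕ) : ℝ) - 1) / (((k + 1 : ℕ) : ℝ) + 2)) • (x' - x))

/-- `Y' + F(t, Y) = 0` on `[0, T]`, with `Y(0) = y₀`. -/
def SolvesFirstOrder {E : Type*} [NormedAddCommGroup E] [NormedSpace ℝ E] {T : ℝ} (hT : 0 < T)
    (F : Icc (0 : ℝ) T → E → E) (y₀ : E) (Y : C(Icc (0 : ℝ) T, E)) : Prop :=
  Y ⟨0, left_mem_Icc.2 hT.le⟩ = y₀ ∧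
  ∀ t : Icc (0 : ℝ) T, HasDerivWithinAt (IccExtend hT.le Y) (-F t (Y t)) (Icc 0 T) t

/-- `Y'' + (3/t) Y' + F(t, Y) = 0` on `(0, T]`, with `Y` continuously differentiable on `[0, T]`,
`Y(0) = y₀` and `Y'(0) = 0`. -/
def SolvesSecondOrder {E : Type*} [NormedAddCommGroup E] [NormedSpace ℝ E] {T : ℝ} (hT : 0 < T)
    (F : Icc (0 : ℝ) T → E → E) (y₀ : E) (Y : C(Icc (0 : ℝ) T, E)) : Prop :=
  Y ⟨0, left_mem_Icc.2 hT.le⟩ = y₀ ∧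
  ∃ Y' : C(Icc (0 : ℝ) T, E), Y' ⟨0, left_mem_Icc.2 hT.le⟩ = 0 ∧
    (∀ t : Icc (0 : ℝ) T, HasDerivWithinAt (IccExtend hT.le Y) (Y' t) (Icc 0 T) t) ∧
    ∀ t : Icc (0 : ℝ) T, 0 < (t : ℝ) →
      HasDerivWithinAt (IccExtend hT.le Y') (-((3 / (t : ℝ)) • Y' t) - F t (Y t)) (Icc 0 T) t

namespace DescentMethod

/-- The length of time that one iteration stands for: `δ` (plain) or `√δ` (accelerated). -/
def timeStep : DescentMethod → ℝ → ℝ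
  | plain, δ => δ
  | accelerated, δ => √δ

/-- The sequence `x_k` that the method with step size `δ` produces for the gradient field `F`,
started at `x₀`. -/
def iterate {E : Type*} [AddCommGroup E] [Module ℝ E] :
    DescentMethod → (E → E) → ℝ → E → ℕ → E
  | plain, F, δ, x₀ => plainIterate F δ x₀
  | accelerated, F, δ, x₀ => fun k => (acceleratedIterate F δ x₀ k).1

/-- `Y` solves on `[0, T]` the initial value problem of the method:
`Y' + F(t, Y) = 0`, `Y(0) = y₀` (plain), or
`Y'' + (3/t) Y' + F(t, Y) = 0`, `Y(0) = y₀`, `Y'(0) = 0` (accelerated). -/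
def Solves {E : Type*} [NormedAddCommGroup E] [NormedSpace ℝ E] :
    DescentMethod → ∀ {T : ℝ}, 0 < T → (Icc (0 : ℝ) T → E → E) → E → C(Icc (0 : ℝ) T, E) → Prop
  | plain, _, hT, F, y₀, Y => SolvesFirstOrder hT F y₀ Y
  | accelerated, _, hT, F, y₀, Y => SolvesSecondOrder hT F y₀ Y

end DescentMethod

/-! ### The stochastic optimization problem -/

/-- The Hessian of `f`, as a linear map. -/
def hess {E : Type*} [NormedAddCommGroup E] [InnerProductSpace ℝ E] [CompleteSpace E]
    (f : E → ℝ) (θ : E) : E →L[ℝ] E := fderiv ℝ (∇ f) θ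

/-- The empirical risk `(1/n) ∑ᵢ ℓ(θ; uᵢ)`. -/
def empRisk {E S : Type*} {n : ℕ} (ℓ : E → S → ℝ) (u : Fin n → S) (θ : E) : ℝ :=
  (1 / (n : ℝ)) * ∑ i, ℓ θ (u i)

/-- The gradient of the empirical risk on the parameter set `Θ`. Outside `Θ`, where the loss is
not part of the problem, it is set to `0`, only to have a total function. -/
def empGrad {E S : Type*} [NormedAddCommGroup E] [InnerProductSpace ℝ E] [CompleteSpace E] {n : ℕ}
    (ℓ : E → S → ℝ) (Θ : Set E) (u : Fin n → S) : E → E :=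
  Θ.indicator (∇ (empRisk ℓ u))

/-- The cross-covariance matrix `Cov[∂ᵢ ℓ(θ; U), ∂ⱼ ℓ(ϑ; U)]` for `U ∼ Q`. -/
def gradCov {p : ℕ} {S : Type*} [MeasurableSpace S] (ℓ : EuclideanSpace ℝ (Fin p) → S → ℝ)
    (Q : Measure S) (θ ϑ : EuclideanSpace ℝ (Fin p)) : Matrix (Fin p) (Fin p) ℝ :=
  Matrix.of fun i j => covariance (fun u => ∇ (fun x => ℓ x u) θ i) (fun u => ∇ (fun x => ℓ x u) ϑ j) Q

/-- The loss is twice continuously differentiable on `Θ`, its gradient is Lipschitz on `Θ` with a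
random constant `h₁(U)` that has a finite fourth moment, and the gradient at some point has a
finite fourth moment. -/
structure RegularLoss {p : ℕ} {S : Type*} [MeasurableSpace S] (Θ : Set (EuclideanSpace ℝ (Fin p)))
    (ℓ : EuclideanSpace ℝ (Fin p) → S → ℝ) (Q : Measure S) : Prop where
  measurable : ∀ θ ∈ Θ, Measurable (ℓ θ)
  contDiffOn : ∀ u, ContDiffOn ℝ 2 (fun θ => ℓ θ u) Θ
  lipschitz : ∃ h₁ : S → ℝ, MemLp h₁ 4 Q ∧ ∀ u, ∀ θ ∈ Θ, ∀ ϑ ∈ Θ,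
    ‖∇ (fun x => ℓ x u) θ - ∇ (fun x => ℓ x u) ϑ‖ ≤ h₁ u * ‖θ - ϑ‖
  moment : ∃ θ₀ ∈ Θ, MemLp (fun u => ∇ (fun x => ℓ x u) θ₀) 4 Q

/-- `g` is the expected loss on `Θ`, expectation and the first two derivatives may be interchanged,
and `g` is twice continuously differentiable and strongly convex with Lipschitz gradient. -/
structure RegularRisk {p : ℕ} {S : Type*} [MeasurableSpace S] (Θ : Set (EuclideanSpace ℝ (Fin p)))
    (ℓ : EuclideanSpace ℝ (Fin p) → S → ℝ) (Q : Measure S)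
    (g : EuclideanSpace ℝ (Fin p) → ℝ) : Prop where
  integrable : ∀ θ ∈ Θ, Integrable (ℓ θ) Q
  integral_eq : ∀ θ ∈ Θ, ∫ u, ℓ θ u ∂Q = g θ
  integral_grad : ∀ θ ∈ Θ, ∫ u, ∇ (fun x => ℓ x u) θ ∂Q = ∇ g θ
  integral_hess : ∀ θ ∈ Θ, ∫ u, hess (fun x => ℓ x u) θ ∂Q = hess g θ
  contDiffOn : ContDiffOn ℝ 2 g Θ
  strongConvexOn : ∃ m : ℝ, 0 < m ∧ StrongConvexOn Θ m g
  lipschitz : ∃ L : ℝ≥0, LipschitzOnWith L (∇ g) Θ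

/-- The cross-covariances of the gradient are continuously differentiable and Lipschitz, and the
covariance matrix of the gradient at each point is positive definite. -/
structure RegularCov {p : ℕ} {S : Type*} [MeasurableSpace S] (Θ : Set (EuclideanSpace ℝ (Fin p)))
    (ℓ : EuclideanSpace ℝ (Fin p) → S → ℝ) (Q : Measure S) : Prop where
  contDiffOn : ∀ i j, ContDiffOn ℝ 1
    (fun q : EuclideanSpace ℝ (Fin p) × EuclideanSpace ℝ (Fin p) => gradCov ℓ Q q.1 q.2 i j) (Θ ×ˢ Θ)
  lipschitz : ∃ L : ℝ≥0, ∀ i j, LipschitzOnWith L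
    (fun q : EuclideanSpace ℝ (Fin p) × EuclideanSpace ℝ (Fin p) => gradCov ℓ Q q.1 q.2 i j) (Θ ×ˢ Θ)
  posDef : ∀ θ ∈ Θ, (gradCov ℓ Q θ θ).PosDef

/-- `Z` is, on the set `A`, a Gaussian process with mean zero and with the auto-covariance of the
gradient of the loss. -/
structure IsGaussianField {p : ℕ} {S Ω' : Type*} [MeasurableSpace S] [MeasurableSpace Ω']
    (P' : Measure Ω') (A : Set (EuclideanSpace ℝ (Fin p)))
    (ℓ : EuclideanSpace ℝ (Fin p) → S → ℝ) (Q : Measure S)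
    (Z : Ω' → EuclideanSpace ℝ (Fin p) → EuclideanSpace ℝ (Fin p)) : Prop where
  gaussian : IsGaussianProcess (fun (θ : A) ω => Z ω θ) P'
  mean_zero : ∀ θ ∈ A, ∫ ω, Z ω θ ∂P' = 0
  cov : ∀ θ ∈ A, ∀ ϑ ∈ A, ∀ i j,
    covariance (fun ω => Z ω θ i) (fun ω => Z ω ϑ j) P' = gradCov ℓ Q θ ϑ i j

end

/-! Both initial value problems are treated as one Volterra equation `Y t = y₀ - displacement a f t`
with `f t = F(t, Y t)`. For the accelerated equation `t³` is an integrating factor, `(t³ Y')' = -t³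
f`, which removes the singularity at `0`. In both cases the velocity is bounded by `max 1 T` times
the supremum of `f` over the past, so one Gronwall inequality serves both, and a linear equation is
solved by a Neumann series, with a bounded solution operator `Φ` on the continuous paths.

The deterministic core is `exists_discretization_bound`. Let `Y` be driven by a bounded `G` that
differs along `Y` by at most `η` from a Lipschitz field `F`. Then the iterates of `F` started at
`x₀` stay within `M (√δ + ‖x₀ - y₀‖ + η)` of `Y`. For the plain method this is Euler's method. For
the accelerated one, `t (t + h) (t + 2h)` is an exact integrating factor of the recursion, the
discrete counterpart of `t³`. A Lipschitz extension and a tube around the path reduce a field on `Θ`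
to a field on the whole space.

For (i), the bound is applied to the exact solution for the empirical gradient, with `η = 0` and
equal initial values. The error is even `O_P(√δ)`; the logarithm only enlarges the bound.

For (ii), with `c = √n` and the path `z` of the rescaled gradient error along `X`, the bound is
applied to the explicit path `X + c⁻¹ Φ z`. Its residual consists of the linearization error of `∇
g` and an increment of the rescaled process over a distance of order `c⁻¹`, so it is `o(c⁻¹)` on
events of large probability. Hence `c (x - X)` is uniformly close to `Φ z`, and the limit follows by
continuous mapping with `V = Φ (Z ∘ X)`.

The probabilistic input is weak convergence in the uniform topology, through the portmanteau
inequality for closed sets. It gives the uniform continuity of the limit, bounds along `X` and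
asymptotic equicontinuity. Markov's inequality controls the random Lipschitz constants. -/

noncomputable section

/-! ### The differential equations in integral form -/

namespace DescentMethod

variable {E : Type*} [NormedAddCommGroup E] [NormedSpace ℝ E]

/-- Minus the derivative of the solution of the initial value problem of the method with the
field `F(t, y) = f t`. -/
def velocity (a : DescentMethod) (f : ℝ → E) (r : ℝ) : E :=
  match a with
  | plain => f r
  | accelerated => (r ^ 3)⁻¹ • ∫ s in (0 : ℝ)..r, s ^ 3 • f s

/-- The distance vector from the solution of the initial value problem of the method with the
field `F(t, y) = f t` to the initial value. -/
def displacement (a : DescentMethod) (f : ℝ → E) (t : ℝ) : E :=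
  ∫ r in (0 : ℝ)..t, velocity a f r

theorem norm_integral_cube_smul_le {f : ℝ → E} {r c : ℝ} (hf : ∀ s ∈ uIcc 0 r, ‖f s‖ ≤ c) :
    ‖∫ s in (0 : ℝ)..r, s ^ 3 • f s‖ ≤ |r| ^ 4 * c := by
  have h : ∀ s ∈ uIoc 0 r, ‖s ^ 3 • f s‖ ≤ |r| ^ 3 * c := fun s hs => by
    have hs' : s ∈ uIcc 0 r := uIoc_subset_uIcc hs
    have h1 : |s| ≤ |r| := by
      have := abs_sub_left_of_mem_uIcc hs'
      simpa using this
    rw [norm_smul, norm_pow, Real.norm_eq_abs]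
    exact mul_le_mul (pow_le_pow_left₀ (abs_nonneg _) h1 3) (hf s hs') (norm_nonneg _)
      (by positivity)
  refine (intervalIntegral.norm_integral_le_of_norm_le_const h).trans (le_of_eq ?_)
  rw [sub_zero]; ring

/-- The weight `s³` gains a fourth power of `r` under the integral, so one factor `|r|` survives the
division by `r³`. This factor yields the continuity at `0` and the initial condition `Y'(0) = 0`. -/
theorem norm_velocity_accelerated_le {f : ℝ → E} {r c : ℝ} (hf : ∀ s ∈ uIcc 0 r, ‖f s‖ ≤ c) :
    ‖velocity accelerated f r‖ ≤ |r| * c := by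
  rcases eq_or_ne r 0 with rfl | hr
  · simp [velocity]
  have hr' : 0 < |r| := abs_pos.2 hr
  rw [velocity, norm_smul, norm_inv, norm_pow, Real.norm_eq_abs, inv_mul_le_iff₀ (by positivity)]
  refine (norm_integral_cube_smul_le hf).trans (le_of_eq (by ring))

theorem norm_velocity_le (a : DescentMethod) {f : ℝ → E} {r c : ℝ} (hr : 0 ≤ r)
    (hf : ∀ s ∈ Icc 0 r, ‖f s‖ ≤ c) : ‖velocity a f r‖ ≤ max 1 r * c := by
  have hc : 0 ≤ c := (norm_nonneg _).trans (hf 0 ⟨le_rfl, hr⟩)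
  cases a
  · exact (hf r ⟨hr, le_rfl⟩).trans (le_mul_of_one_le_left hc (le_max_left _ _))
  · refine (norm_velocity_accelerated_le (by rwa [uIcc_of_le hr])).trans ?_
    rw [abs_of_nonneg hr]
    exact mul_le_mul_of_nonneg_right (le_max_right _ _) hc

theorem norm_velocity_le_of_le (a : DescentMethod) {f : ℝ → E} {r c T : ℝ} (hr : r ∈ Icc 0 T)
    (hf : ∀ s ∈ Icc 0 r, ‖f s‖ ≤ c) : ‖velocity a f r‖ ≤ max 1 T * c :=
  (norm_velocity_le a hr.1 hf).trans (mul_le_mul_of_nonneg_right (max_le_max le_rfl hr.2)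
    ((norm_nonneg _).trans (hf 0 ⟨le_rfl, hr.1⟩)))

theorem continuous_velocity (a : DescentMethod) {f : ℝ → E} (hf : Continuous f) :
    Continuous (velocity a f) := by
  cases a
  · exact hf
  refine continuous_iff_continuousAt.2 fun r => ?_
  rcases eq_or_ne r 0 with rfl | hr
  · obtain ⟨c, hc⟩ := (isCompact_Icc (a := (-1 : ℝ)) (b := 1)).exists_bound_of_continuousOn
      hf.continuousOn
    have h0 : velocity accelerated f 0 = 0 := by simp [velocity]
    rw [ContinuousAt, h0]
    refine squeeze_zero_norm' (a := fun r => |r| * c) ?_ ?_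
    · filter_upwards [Icc_mem_nhds (show (-1 : ℝ) < 0 by norm_num) one_pos] with r hr
      refine norm_velocity_accelerated_le fun s hs => hc s ?_
      exact uIcc_subset_Icc (by simp) hr hs
    · have : Continuous fun r : ℝ => |r| * c := by fun_prop
      simpa using this.tendsto 0
  · have hi : Continuous fun r => ∫ s in (0 : ℝ)..r, s ^ 3 • f s :=
      intervalIntegral.continuous_primitive
        (fun a b => (by fun_prop : Continuous fun s : ℝ => s ^ 3 • f s).intervalIntegrable a b) 0
    exact ((continuousAt_id.pow 3).inv₀ (by simpa using hr)).smul hi.continuousAt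

theorem velocity_add (a : DescentMethod) {f g : ℝ → E} (hf : Continuous f) (hg : Continuous g) :
    velocity a (f + g) = velocity a f + velocity a g := by
  funext r
  cases a
  · rfl
  · simp only [velocity, Pi.add_apply, smul_add]
    rw [intervalIntegral.integral_add, smul_add]
    · exact (by fun_prop : Continuous fun s : ℝ => s ^ 3 • f s).intervalIntegrable _ _
    · exact (by fun_prop : Continuous fun s : ℝ => s ^ 3 • g s).intervalIntegrable _ _

theorem velocity_const_smul (a : DescentMethod) (c : ℝ) (f : ℝ → E) :
    velocity a (c • f) = c • velocity a f := by
  funext r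
  cases a
  · rfl
  · simp only [velocity, Pi.smul_apply]
    rw [smul_comm c, ← intervalIntegral.integral_smul c]
    exact congrArg _ (intervalIntegral.integral_congr fun s _ => smul_comm (s ^ 3) c (f s))

theorem displacement_sub (a : DescentMethod) {f : ℝ → E} (hf : Continuous f) (s t : ℝ) :
    displacement a f t - displacement a f s = ∫ r in s..t, velocity a f r :=
  intervalIntegral.integral_interval_sub_left ((continuous_velocity a hf).intervalIntegrable _ _)
    ((continuous_velocity a hf).intervalIntegrable _ _)

theorem displacement_add (a : DescentMethod) {f g : ℝ → E} (hf : Continuous f)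
    (hg : Continuous g) (t : ℝ) :
    displacement a (f + g) t = displacement a f t + displacement a g t := by
  rw [displacement, velocity_add a hf hg]
  exact intervalIntegral.integral_add ((continuous_velocity a hf).intervalIntegrable _ _)
    ((continuous_velocity a hg).intervalIntegrable _ _)

theorem displacement_const_smul (a : DescentMethod) (c : ℝ) (f : ℝ → E) (t : ℝ) :
    displacement a (c • f) t = c • displacement a f t := by
  rw [displacement, velocity_const_smul]
  exact intervalIntegral.integral_smul _ _

variable [CompleteSpace E]

theorem hasDerivAt_velocity_accelerated {f : ℝ → E} (hf : Continuous f) {t : ℝ} (ht : 0 < t) :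
    HasDerivAt (velocity accelerated f) (f t - (3 / t) • velocity accelerated f t) t := by
  have hg : Continuous fun s : ℝ => s ^ 3 • f s := by fun_prop
  have h1 := (hg.integral_hasStrictDerivAt 0 t).hasDerivAt
  have h2 : HasDerivAt (fun r : ℝ => (r ^ 3)⁻¹) (-(3 * t ^ 2) / (t ^ 3) ^ 2) t := by
    simpa using (hasDerivAt_pow 3 t).fun_inv (by positivity)
  have h3 := h2.smul h1
  refine h3.congr_deriv ?_
  simp only [velocity, smul_smul]
  rw [inv_mul_cancel₀ (by positivity), one_smul, sub_eq_add_neg, ← neg_smul]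
  congr 2
  field_simp

theorem hasDerivAt_displacement (a : DescentMethod) {f : ℝ → E} (hf : Continuous f) (t : ℝ) :
    HasDerivAt (displacement a f) (velocity a f t) t :=
  ((continuous_velocity a hf).integral_hasStrictDerivAt 0 t).hasDerivAt

theorem continuous_displacement (a : DescentMethod) {f : ℝ → E} (hf : Continuous f) :
    Continuous (displacement a f) :=
  continuous_iff_continuousAt.2 fun t => (hasDerivAt_displacement a hf t).continuousAt

theorem sub_eq_integral_of_hasDerivWithinAt {g v : ℝ → E} {T : ℝ}
    (hg : ∀ t ∈ Icc 0 T, HasDerivWithinAt g (v t) (Icc 0 T) t) (hv : ContinuousOn v (Icc 0 T))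
    {t : ℝ} (ht : t ∈ Icc 0 T) : g t - g 0 = ∫ r in (0 : ℝ)..t, v r := by
  have hsub : Icc 0 t ⊆ Icc 0 T := Icc_subset_Icc_right ht.2
  refine (intervalIntegral.integral_eq_sub_of_hasDerivAt_of_le ht.1
    (fun s hs => ((hg s (hsub hs)).continuousWithinAt.mono hsub)) (fun s hs => ?_) ?_).symm
  · exact (hg s (hsub (Ioo_subset_Icc_self hs))).hasDerivAt
      (Icc_mem_nhds hs.1 (hs.2.trans_le ht.2))
  · exact (hv.mono (by rw [uIcc_of_le ht.1]; exact hsub)).intervalIntegrable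

/-- A continuous path solves the initial value problem of the method if and only if it satisfies
the corresponding integral equation. -/
theorem solves_iff (a : DescentMethod) {T : ℝ} (hT : 0 < T) {F : Icc (0 : ℝ) T → E → E} {y₀ : E}
    {Y : C(Icc (0 : ℝ) T, E)} {f : ℝ → E} (hf : Continuous f)
    (hfF : ∀ t : Icc (0 : ℝ) T, f t = F t (Y t)) :
    a.Solves hT F y₀ Y ↔ ∀ t : Icc (0 : ℝ) T, Y t = y₀ - displacement a f t := by
  have hext : ∀ (Y : C(Icc (0 : ℝ) T, E)) (t : Icc (0 : ℝ) T), IccExtend hT.le Y t = Y t :=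
    fun Y t => IccExtend_val hT.le Y t
  have hext0 : ∀ (Y : C(Icc (0 : ℝ) T, E)),
      IccExtend hT.le Y 0 = Y ⟨0, left_mem_Icc.2 hT.le⟩ :=
    fun Y => IccExtend_of_mem hT.le Y (left_mem_Icc.2 hT.le)
  constructor
  · cases a
    · rintro ⟨h0, h1⟩ t
      have := sub_eq_integral_of_hasDerivWithinAt (g := IccExtend hT.le Y) (v := -f)
        (fun t ht => by
          have := h1 ⟨t, ht⟩
          rwa [← hfF] at this) hf.neg.continuousOn t.2
      rw [hext, hext0, h0] at this
      rw [sub_eq_iff_eq_add'.1 this, sub_eq_add_neg, displacement]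
      simp [velocity]
    · rintro ⟨h0, Y', hY'0, h1, h2⟩ t
      -- The function `r³ Y'` has derivative `-r³ f` on `(0, t)`, is continuous up to `0` and
      -- vanishes there. At `t = 0` itself, `(0 ^ 3)⁻¹ = 0` makes the velocity zero, in agreement
      -- with the initial condition.
      have hv : ∀ t ∈ Icc 0 T, IccExtend hT.le Y' t = -velocity accelerated f t := by
        intro t ht
        rcases ht.1.eq_or_lt with rfl | ht0
        · rw [hext0, hY'0]
          simp [velocity]
        have hc : Continuous fun r : ℝ => r ^ 3 • IccExtend hT.le Y' r :=
          (continuous_id.pow 3).smul Y'.continuous.Icc_extend'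
        have hc' : Continuous fun r : ℝ => -(r ^ 3 • f r) := by fun_prop
        have := intervalIntegral.integral_eq_sub_of_hasDerivAt_of_le (a := 0) (b := t)
          (f := fun r : ℝ => r ^ 3 • IccExtend hT.le Y' r) (f' := fun r => -(r ^ 3 • f r))
          ht0.le hc.continuousOn (fun s hs => by
            have hs' : s ∈ Icc 0 T := ⟨hs.1.le, hs.2.le.trans ht.2⟩
            have h3 := (h2 ⟨s, hs'⟩ hs.1).hasDerivAt (Icc_mem_nhds hs.1 (hs.2.trans_le ht.2))
            have h4 := (hasDerivAt_pow 3 s).smul h3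
            refine h4.congr_deriv ?_
            have hs0 : s ≠ 0 := hs.1.ne'
            rw [← hfF, IccExtend_of_mem hT.le Y' hs', smul_sub, smul_neg, smul_smul,
              show s ^ 3 * (3 / s) = 3 * s ^ 2 by field_simp]
            simp only [Nat.cast_ofNat, Nat.add_one_sub_one]
            abel) (hc'.intervalIntegrable _ _)
        simp only [intervalIntegral.integral_neg] at this
        rw [velocity, ← smul_neg, this]
        simp only [ne_eq, OfNat.ofNat_ne_zero, not_false_eq_true, zero_pow, zero_smul, sub_zero]
        rw [smul_smul, inv_mul_cancel₀ (by positivity), one_smul]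
      have := sub_eq_integral_of_hasDerivWithinAt (g := IccExtend hT.le Y)
        (v := -velocity accelerated f)
        (fun t ht => by
          have h3 := h1 ⟨t, ht⟩
          rwa [← IccExtend_of_mem hT.le Y' ht, hv t ht] at h3)
        (continuous_velocity accelerated hf).neg.continuousOn t.2
      rw [hext, hext0, h0] at this
      rw [sub_eq_iff_eq_add'.1 this, sub_eq_add_neg, displacement]
      simp
  · intro hY
    have hY0 : Y ⟨0, left_mem_Icc.2 hT.le⟩ = y₀ := by
      rw [hY]; simp [displacement]
    have hder : ∀ t : Icc (0 : ℝ) T,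
        HasDerivWithinAt (IccExtend hT.le Y) (-velocity a f t) (Icc 0 T) t := by
      intro t
      refine ((hasDerivAt_displacement a hf t).const_sub y₀).hasDerivWithinAt.congr
        (fun s hs => ?_) ?_
      · rw [IccExtend_of_mem hT.le Y hs, hY]
      · rw [hext, hY]
    cases a
    · refine ⟨hY0, fun t => ?_⟩
      rw [← hfF]
      exact hder t
    · refine ⟨hY0, ⟨fun t => -velocity accelerated f t,
        ((continuous_velocity accelerated hf).comp continuous_subtype_val).neg⟩, ?_, hder, ?_⟩
      · simp [velocity]
      · intro t ht
        rw [← hfF]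
        refine ((hasDerivAt_velocity_accelerated hf ht).neg.hasDerivWithinAt.congr_deriv
          ?_).congr (fun s hs => ?_) ?_
        · simp only [ContinuousMap.coe_mk, smul_neg]; abel
        · rw [IccExtend_of_mem hT.le _ hs]; rfl
        · rw [hext]; rfl

end DescentMethod

end

/-! ### Gronwall's inequality and the solution operator of the linear equation -/

noncomputable section

namespace DescentMethod

variable {E : Type*} [NormedAddCommGroup E] [NormedSpace ℝ E]

/-- A Gronwall inequality for both integral equations. -/
theorem norm_le_of_eq_sub_displacement (a : DescentMethod) {T L η : ℝ} (hL : 0 ≤ L) (hη : 0 ≤ η)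
    {D f : ℝ → E} {d : E} (hD : ContinuousOn D (Icc 0 T))
    (hDf : ∀ t ∈ Icc 0 T, D t = d - displacement a f t)
    (hf : ∀ t ∈ Icc 0 T, ‖f t‖ ≤ L * ‖D t‖ + η) {t : ℝ} (ht : t ∈ Icc 0 T) :
    ‖D t‖ ≤ 2 * Real.exp ((2 * max 1 T * L + 1) * T) * (‖d‖ + max 1 T * η * T) := by
  set κ := max 1 T with hκ
  have hκ1 : 1 ≤ κ := le_max_left _ _
  set w := 2 * κ * L + 1 with hw
  have hw0 : 0 < w := by positivity
  have hT : 0 ≤ T := ht.1.trans ht.2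
  -- The accelerated velocity depends on the whole past, so no differential inequality for `‖D‖` is
  -- available; an exponentially weighted norm is maximized instead.
  obtain ⟨m, hm, hmax⟩ := (isCompact_Icc (a := (0 : ℝ)) (b := T)).exists_isMaxOn
    ⟨0, left_mem_Icc.2 hT⟩
    (f := fun t => Real.exp (-(w * t)) * ‖D t‖)
    ((by fun_prop : Continuous fun t : ℝ => Real.exp (-(w * t))).continuousOn.mul hD.norm)
  set N := Real.exp (-(w * m)) * ‖D m‖ with hN
  have hN0 : 0 ≤ N := by positivity
  have hDN : ∀ s ∈ Icc 0 T, ‖D s‖ ≤ N * Real.exp (w * s) := fun s hs => by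
    have := mul_le_mul_of_nonneg_right (hmax hs) (Real.exp_pos (w * s)).le
    simp only at this
    rwa [mul_right_comm, ← Real.exp_add, neg_add_cancel, Real.exp_zero, one_mul] at this
  have hvel : ∀ r ∈ Icc 0 T, ‖velocity a f r‖ ≤ κ * (L * (N * Real.exp (w * r)) + η) := by
    intro r hr
    refine norm_velocity_le_of_le a hr fun s hs => ?_
    have hsT : s ∈ Icc 0 T := ⟨hs.1, hs.2.trans hr.2⟩
    refine (hf s hsT).trans (add_le_add_left (mul_le_mul_of_nonneg_left ((hDN s hsT).trans ?_) hL) _)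
    exact mul_le_mul_of_nonneg_left
      (Real.exp_le_exp.2 (mul_le_mul_of_nonneg_left hs.2 hw0.le)) hN0
  have hint : ∫ r in (0 : ℝ)..m, κ * (L * (N * Real.exp (w * r)) + η)
      = κ * L * N / w * (Real.exp (w * m) - 1) + κ * η * m := by
    have := intervalIntegral.integral_eq_sub_of_hasDerivAt (a := 0) (b := m)
      (f := fun r => κ * L * N / w * Real.exp (w * r) + κ * η * r)
      (f' := fun r => κ * (L * (N * Real.exp (w * r)) + η)) (fun r _ => by
        have h1 := (((hasDerivAt_id r).const_mul w).exp.const_mul (κ * L * N / w)).add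
          ((hasDerivAt_id r).const_mul (κ * η))
        refine h1.congr_deriv ?_
        simp only [id]
        field_simp)
      ((by fun_prop : Continuous fun r => κ * (L * (N * Real.exp (w * r)) + η)).intervalIntegrable
        _ _)
    rw [this]; simp; ring
  have hdisp : ‖displacement a f m‖ ≤ κ * L * N / w * (Real.exp (w * m) - 1) + κ * η * m := by
    rw [← hint]
    refine intervalIntegral.norm_integral_le_of_norm_le hm.1 (ae_of_all _ fun r hr => ?_)
      ((by fun_prop : Continuous fun r => κ * (L * (N * Real.exp (w * r)) + η)).intervalIntegrable
        _ _)
    exact hvel r ⟨hr.1.le, hr.2.trans hm.2⟩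
  have hNm : N * Real.exp (w * m) = ‖D m‖ := by
    rw [hN, mul_right_comm, ← Real.exp_add, neg_add_cancel, Real.exp_zero, one_mul]
  have hq : κ * L / w ≤ 1 / 2 := by
    rw [div_le_div_iff₀ hw0 two_pos]; linarith
  have hq0 : 0 ≤ κ * L / w := by positivity
  have hDm : ‖D m‖ ≤ 2 * (‖d‖ + κ * η * T) := by
    have h1 : ‖D m‖ ≤ ‖d‖ + (κ * L * N / w * (Real.exp (w * m) - 1) + κ * η * m) := by
      rw [hDf m hm]
      exact (norm_sub_le _ _).trans (add_le_add_right hdisp _)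
    have h2 : κ * L * N / w * (Real.exp (w * m) - 1) ≤ ‖D m‖ / 2 := by
      have h3 : κ * L * N / w * (Real.exp (w * m) - 1)
          = κ * L / w * ‖D m‖ - κ * L / w * N := by rw [← hNm]; ring
      rw [h3]
      have := mul_le_mul_of_nonneg_right hq (norm_nonneg (D m))
      have := mul_nonneg hq0 hN0
      linarith
    have h4 : κ * η * m ≤ κ * η * T := mul_le_mul_of_nonneg_left hm.2 (by positivity)
    linarith
  have hNle : N ≤ ‖D m‖ := by
    rw [← hNm]
    exact le_mul_of_one_le_right hN0 (Real.one_le_exp (mul_nonneg hw0.le hm.1))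
  calc ‖D t‖ ≤ N * Real.exp (w * t) := hDN t ht
    _ ≤ 2 * (‖d‖ + κ * η * T) * Real.exp (w * T) :=
      mul_le_mul (hNle.trans hDm) (Real.exp_le_exp.2 (mul_le_mul_of_nonneg_left ht.2 hw0.le))
        (Real.exp_pos _).le (by positivity)
    _ = _ := by ring

/-- The displacement, as an operator on the continuous paths. -/
def displacementCLM (a : DescentMethod) {T : ℝ} (hT : 0 ≤ T) [CompleteSpace E] :
    C(Icc (0 : ℝ) T, E) →L[ℝ] C(Icc (0 : ℝ) T, E) :=
  LinearMap.mkContinuous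
    { toFun := fun f => ⟨fun t => displacement a (IccExtend hT f) t,
        (continuous_displacement a f.continuous.Icc_extend').comp continuous_subtype_val⟩
      map_add' := fun f g => by
        ext t
        exact displacement_add a f.continuous.Icc_extend' g.continuous.Icc_extend' t
      map_smul' := fun c f => by
        ext t
        exact displacement_const_smul a c (IccExtend hT f) t }
    (max 1 T * T) fun f => by
      rw [ContinuousMap.norm_le _ (by positivity)]
      intro t
      have h := intervalIntegral.norm_integral_le_of_norm_le_const (a := 0) (b := (t : ℝ))
        (f := velocity a (IccExtend hT f)) (C := max 1 T * ‖f‖) fun r hr => by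
          rw [uIoc_of_le t.2.1] at hr
          exact norm_velocity_le_of_le a ⟨hr.1.le, hr.2.trans t.2.2⟩
            fun s _ => f.norm_coe_le_norm _
      rw [sub_zero, abs_of_nonneg t.2.1] at h
      refine h.trans ?_
      rw [mul_right_comm]
      exact mul_le_mul_of_nonneg_right (mul_le_mul_of_nonneg_left t.2.2 (by positivity))
        (norm_nonneg f)

/-- Pointwise application of a continuous path of operators to a continuous path. -/
def pathApply {T : ℝ} (A : C(Icc (0 : ℝ) T, E →L[ℝ] E)) :
    C(Icc (0 : ℝ) T, E) →L[ℝ] C(Icc (0 : ℝ) T, E) :=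
  LinearMap.mkContinuous
    { toFun := fun f => ⟨fun t => A t (f t), A.continuous.clm_apply f.continuous⟩
      map_add' := fun f g => by ext t; simp
      map_smul' := fun c f => by ext t; simp }
    ‖A‖ fun f => by
      rw [ContinuousMap.norm_le _ (by positivity)]
      intro t
      exact (A t).le_of_opNorm_le_of_le (A.norm_coe_le_norm t) (f.norm_coe_le_norm t)

variable [CompleteSpace E]

/-- The operator is of Volterra type: each application integrates the previous bound once, which
produces the factorial. The bound must depend on `t`, since this is what the induction integrates.
-/
theorem norm_displacementCLM_comp_pow_apply_le (a : DescentMethod) {T : ℝ} (hT : 0 ≤ T)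
    (A : C(Icc (0 : ℝ) T, E →L[ℝ] E)) (n : ℕ) (f : C(Icc (0 : ℝ) T, E)) (t : Icc (0 : ℝ) T) :
    ‖((displacementCLM a hT ∘L pathApply A) ^ n) f t‖
      ≤ (max 1 T * ‖A‖ * t) ^ n / n.factorial * ‖f‖ := by
  induction n generalizing t with
  | zero => simpa using f.norm_coe_le_norm t
  | succ n ih =>
    set g := ((displacementCLM a hT ∘L pathApply A) ^ n) f with hg
    have h0 : ((displacementCLM a hT ∘L pathApply A) ^ (n + 1)) f t
        = displacement a (IccExtend hT (pathApply A g)) t := by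
      rw [pow_succ']; rfl
    rw [h0]
    set κ := max 1 T with hκ
    set c := κ * ‖A‖ with hc
    have hc0 : 0 ≤ c := by positivity
    have hvel : ∀ r ∈ Ioc 0 (t : ℝ), ‖velocity a (IccExtend hT (pathApply A g)) r‖
        ≤ c * ((c * r) ^ n / n.factorial * ‖f‖) := by
      intro r hr
      have hrT : r ∈ Icc 0 T := ⟨hr.1.le, hr.2.trans t.2.2⟩
      rw [hc, mul_assoc κ]
      refine norm_velocity_le_of_le a hrT fun s hs => ?_
      have hsT : s ∈ Icc 0 T := ⟨hs.1, hs.2.trans hrT.2⟩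
      rw [IccExtend_of_mem hT _ hsT]
      refine (A ⟨s, hsT⟩).le_of_opNorm_le_of_le (A.norm_coe_le_norm _) ((ih ⟨s, hsT⟩).trans ?_)
      have := hs.1
      have := hs.2
      gcongr
    have hcont : Continuous fun r : ℝ => c * ((c * r) ^ n / n.factorial * ‖f‖) := by fun_prop
    have hint : ∫ r in (0 : ℝ)..t, c * ((c * r) ^ n / n.factorial * ‖f‖)
        = (c * t) ^ (n + 1) / (n + 1).factorial * ‖f‖ := by
      have := intervalIntegral.integral_eq_sub_of_hasDerivAt (a := 0) (b := (t : ℝ))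
        (f := fun r => (c * r) ^ (n + 1) / (n + 1).factorial * ‖f‖)
        (f' := fun r => c * ((c * r) ^ n / n.factorial * ‖f‖)) (fun r _ => by
          have h1 := (((((hasDerivAt_id r).const_mul c).pow (n + 1)).div_const
            ((n + 1).factorial : ℝ)).mul_const ‖f‖)
          refine h1.congr_deriv ?_
          have : ((n.factorial : ℕ) : ℝ) ≠ 0 := by positivity
          have : (n : ℝ) + 1 ≠ 0 := by positivity
          simp only [id, Nat.factorial_succ, Nat.cast_mul, Nat.cast_add, Nat.cast_one,
            Nat.add_sub_cancel]
          field_simp)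
        (hcont.intervalIntegrable _ _)
      rw [this]; simp
    rw [← hint]
    exact intervalIntegral.norm_integral_le_of_norm_le t.2.1 (ae_of_all _ hvel)
      (hcont.intervalIntegrable _ _)

/-- The Neumann series `∑ (-B)ⁿ` is a right inverse `R` of `1 + B`, and `Φ = -R J`. Summable bounds
on the powers replace smallness of `B`, so there is no restriction on `T`. -/
theorem exists_eq_neg_sub_of_summable_pow {F : Type*} [NormedAddCommGroup F] [NormedSpace ℝ F]
    [CompleteSpace F] (B J : F →L[ℝ] F) {b : ℕ → ℝ} (hb : Summable b) (hb0 : ∀ n, 0 ≤ b n)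
    (hB : ∀ n f, ‖(B ^ n) f‖ ≤ b n * ‖f‖) :
    ∃ Φ : F →L[ℝ] F, ∀ z, Φ z = -(B (Φ z) + J z) := by
  have hsum : Summable fun n => (-B) ^ n := by
    refine Summable.of_norm_bounded hb fun n => ?_
    have h : ‖(-B) ^ n‖ = ‖B ^ n‖ := by
      rcases n.even_or_odd with h | h
      · rw [h.neg_pow]
      · rw [h.neg_pow, norm_neg]
    rw [h]
    exact ContinuousLinearMap.opNorm_le_bound _ (hb0 n) (hB n)
  have hinv : (1 + B) * ∑' n, (-B) ^ n = 1 := by simpa using hsum.one_sub_mul_tsum_pow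
  generalize (∑' n, (-B) ^ n) = R at hinv
  refine ⟨-(R ∘L J), fun z => ?_⟩
  have h := congrArg (fun S => S (J z)) hinv
  simp only [mul_apply_eq_comp, add_apply,
    one_apply_eq_self] at h
  simp only [neg_apply, ContinuousLinearMap.comp_apply, map_neg]
  rw [neg_add, neg_neg]
  nth_rewrite 3 [← h]
  abel

/-- The solution operator of the linear equation with coefficient `A` and forcing term `z`. -/
theorem exists_solution_operator (a : DescentMethod) {T : ℝ} (hT : 0 ≤ T)
    (A : C(Icc (0 : ℝ) T, E →L[ℝ] E)) :
    ∃ Φ : C(Icc (0 : ℝ) T, E) →L[ℝ] C(Icc (0 : ℝ) T, E), ∀ z t,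
      Φ z t = -displacement a (IccExtend hT (pathApply A (Φ z) + z)) t := by
  obtain ⟨Φ, hΦ⟩ := exists_eq_neg_sub_of_summable_pow (displacementCLM a hT ∘L pathApply A)
    (displacementCLM a hT) (Real.summable_pow_div_factorial (max 1 T * ‖A‖ * T))
    (fun n => by positivity) fun n f => by
      rw [ContinuousMap.norm_le _ (by positivity)]
      intro t
      refine (norm_displacementCLM_comp_pow_apply_le a hT A n f t).trans ?_
      have := t.2.1
      have := t.2.2
      gcongr
  refine ⟨Φ, fun z t => ?_⟩
  have h := hΦ z
  rw [ContinuousLinearMap.comp_apply, ← map_add] at h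
  exact congrArg (fun y : C(Icc (0 : ℝ) T, E) => y t) h

end DescentMethod

end

noncomputable section

/-! ### The discretization error -/

/-- Discrete Gronwall: the right-hand side of the hypothesis grows by a factor of at most `1 + β`
per step. It is bounded here in place of `c K` because it will also dominate the errors of the
iterates, while `c` stands for the errors of the query points. -/
theorem add_mul_sum_range_le_mul_exp {c : ℕ → ℝ} {α β : ℝ} (hα : 0 ≤ α) (hβ : 0 ≤ β) (K : ℕ)
    (hc : ∀ k ≤ K, c k ≤ α + β * ∑ j ∈ Finset.range k, c j) :
    α + β * ∑ j ∈ Finset.range K, c j ≤ α * Real.exp (β * K) := by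
  have h : ∀ k ≤ K, α + β * ∑ j ∈ Finset.range k, c j ≤ α * (1 + β) ^ k := by
    intro k
    induction k with
    | zero => simp
    | succ k ih =>
      intro hk
      have h1 := ih (by omega)
      have h2 := mul_le_mul_of_nonneg_left (hc k (by omega)) hβ
      have h3 := mul_le_mul_of_nonneg_left h1 hβ
      rw [Finset.sum_range_succ, pow_succ]
      linarith
  refine (h K le_rfl).trans (mul_le_mul_of_nonneg_left ?_ hα)
  rw [mul_comm β, Real.exp_nat_mul]
  exact pow_le_pow_left₀ (by positivity) (by linarith [Real.add_one_le_exp β]) K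

namespace DescentMethod

/-- The points at which the method evaluates the gradient field `F`. -/
def query {E : Type*} [AddCommGroup E] [Module ℝ E] :
    DescentMethod → (E → E) → ℝ → E → ℕ → E
  | plain, F, δ, x₀ => plainIterate F δ x₀
  | accelerated, F, δ, x₀ => fun k => (acceleratedIterate F δ x₀ k).2

variable {E : Type*} [NormedAddCommGroup E] [NormedSpace ℝ E]

/-- The path `Y` solves on `[0, T]` the initial value problem of the method for the field `G(t)`,
which is bounded by `B`, and which along `Y` differs by at most `η` from an `L`-Lipschitz field `F`. -/
structure IsApproxSolution (a : DescentMethod) (T L B η : ℝ) (F : E → E) (G Y : ℝ → E) (y₀ : E) :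
    Prop where
  lipschitz : ∀ x y, ‖F x - F y‖ ≤ L * ‖x - y‖
  continuous : Continuous G
  norm_le : ∀ t ∈ Icc 0 T, ‖G t‖ ≤ B
  residual : ∀ t ∈ Icc 0 T, ‖G t - F (Y t)‖ ≤ η
  eq : ∀ t ∈ Icc 0 T, Y t = y₀ - displacement a G t

namespace IsApproxSolution

variable {a : DescentMethod} {T L B η : ℝ} {F : E → E} {G Y : ℝ → E} {y₀ : E}

theorem norm_path_sub_le (H : IsApproxSolution a T L B η F G Y y₀) {s t : ℝ} (hs : 0 ≤ s) (hst : s ≤ t)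
    (ht : t ≤ T) : ‖Y t - Y s‖ ≤ max 1 T * B * (t - s) := by
  rw [H.eq t ⟨hs.trans hst, ht⟩, H.eq s ⟨hs, hst.trans ht⟩, sub_sub_sub_cancel_left, norm_sub_rev,
    displacement_sub a H.continuous]
  have h := intervalIntegral.norm_integral_le_of_norm_le_const (a := s) (b := t)
    (f := velocity a G) (C := max 1 T * B) fun r hr => by
      rw [uIoc_of_le hst] at hr
      have hr' : r ∈ Icc 0 T := ⟨hs.trans hr.1.le, hr.2.trans ht⟩
      exact norm_velocity_le_of_le a hr' fun u hu => H.norm_le u ⟨hu.1, hu.2.trans hr'.2⟩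
  rwa [abs_of_nonneg (sub_nonneg.2 hst)] at h

/-- The three terms come from passing from `G s` to `F (Y s)`, then along the Lipschitz path to `F
(Y t)`, and finally to `F y`. It is used with `t` a grid point and `s` in an adjacent grid interval.
-/
theorem norm_field_sub_le (H : IsApproxSolution a T L B η F G Y y₀) (hL : 0 ≤ L) {s t h : ℝ}
    (hs : s ∈ Icc 0 T) (ht : t ∈ Icc 0 T) (hB : 0 ≤ B) (hst : |t - s| ≤ h) (y : E) :
    ‖G s - F y‖ ≤ η + L * (max 1 T * B) * h + L * ‖y - Y t‖ := by
  have hY : ‖Y s - Y t‖ ≤ max 1 T * B * h := by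
    rcases le_total s t with hle | hle
    · rw [norm_sub_rev]
      refine (H.norm_path_sub_le hs.1 hle ht.2).trans (mul_le_mul_of_nonneg_left ?_ (by positivity))
      exact (le_abs_self _).trans hst
    · refine (H.norm_path_sub_le ht.1 hle hs.2).trans (mul_le_mul_of_nonneg_left ?_ (by positivity))
      rw [abs_sub_comm] at hst
      exact (le_abs_self _).trans hst
  have h1 := H.residual s hs
  have h2 : ‖F (Y s) - F y‖ ≤ L * (max 1 T * B * h + ‖y - Y t‖) := by
    refine (H.lipschitz _ _).trans (mul_le_mul_of_nonneg_left ?_ hL)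
    have := norm_add_le (Y s - Y t) (Y t - y)
    rw [sub_add_sub_cancel, norm_sub_rev (Y t) y] at this
    linarith
  have h3 := norm_add_le (G s - F (Y s)) (F (Y s) - F y)
  rw [sub_add_sub_cancel] at h3
  linarith

variable [CompleteSpace E]

/-- Consistency and stability of Euler's method: one step replaces the integral of `G` over a grid
interval by `h F(x_k)`. -/
theorem plainIterate_le (H : IsApproxSolution plain T L B η F G Y y₀) (hL : 0 ≤ L)
    (hB : 0 ≤ B) {h : ℝ} (hh : 0 < h) (x₀ : E) (k : ℕ) (hk : k * h ≤ T) :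
    ‖plainIterate F h x₀ k - Y (k * h)‖ ≤ ‖x₀ - y₀‖ + k * h * (η + L * (max 1 T * B) * h)
      + L * h * ∑ j ∈ Finset.range k, ‖plainIterate F h x₀ j - Y (j * h)‖ := by
  have hT : 0 ≤ T := le_trans (by positivity) hk
  induction k with
  | zero =>
    have : Y 0 = y₀ := by rw [H.eq 0 ⟨le_rfl, hT⟩]; simp [displacement]
    simp [plainIterate, this]
  | succ k ih =>
    have hle : (k : ℝ) * h ≤ (k + 1 : ℕ) * h := by push_cast; nlinarith
    have hk0 : 0 ≤ (k : ℝ) * h := by positivity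
    have ih' := ih (hle.trans hk)
    set x := plainIterate F h x₀ k with hx
    have hstep : plainIterate F h x₀ (k + 1) - Y ((k + 1 : ℕ) * h)
        = (x - Y (k * h)) + ∫ s in (k * h : ℝ)..((k + 1 : ℕ) * h), (G s - F x) := by
      rw [intervalIntegral.integral_sub (H.continuous.intervalIntegrable _ _)
        (by simp), intervalIntegral.integral_const]
      have h1 := displacement_sub plain H.continuous (k * h) ((k + 1 : ℕ) * h)
      rw [H.eq _ ⟨hk0, hle.trans hk⟩, H.eq _ ⟨hk0.trans hle, hk⟩]
      have h2 : ∫ s in (k * h : ℝ)..((k + 1 : ℕ) * h), G s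
        = displacement plain G ((k + 1 : ℕ) * h) - displacement plain G (k * h) := h1.symm
      rw [h2, show ((k + 1 : ℕ) : ℝ) * h - k * h = h by push_cast; ring]
      simp only [plainIterate, ← hx]
      abel
    have hint : ‖∫ s in (k * h : ℝ)..((k + 1 : ℕ) * h), (G s - F x)‖
        ≤ (η + L * (max 1 T * B) * h + L * ‖x - Y (k * h)‖) * h := by
      have h1 := intervalIntegral.norm_integral_le_of_norm_le_const (a := k * h)
        (b := (k + 1 : ℕ) * h) (f := fun s => G s - F x)
        (C := η + L * (max 1 T * B) * h + L * ‖x - Y (k * h)‖) fun s hs => by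
          rw [uIoc_of_le hle] at hs
          refine H.norm_field_sub_le hL ⟨hk0.trans hs.1.le, hs.2.trans hk⟩
            ⟨hk0, hle.trans hk⟩ hB ?_ x
          rw [abs_of_nonpos (by linarith [hs.1])]
          have := hs.2
          push_cast at this
          linarith
      rwa [show ((k + 1 : ℕ) : ℝ) * h - k * h = h by push_cast; ring, abs_of_pos hh] at h1
    rw [hstep, Finset.sum_range_succ]
    refine (norm_add_le _ _).trans ((add_le_add ih' hint).trans (le_of_eq ?_))
    push_cast
    ring

end IsApproxSolution
end DescentMethod

end

/-! ### The increments of the accelerated iteration -/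

noncomputable section

namespace DescentMethod

variable {E : Type*} [NormedAddCommGroup E] [NormedSpace ℝ E]

theorem acceleratedIterate_succ_fst (F : E → E) (δ : ℝ) (x₀ : E) (k : ℕ) :
    (acceleratedIterate F δ x₀ (k + 1)).1
      = (acceleratedIterate F δ x₀ k).2 - δ • F (acceleratedIterate F δ x₀ k).2 := rfl

theorem acceleratedIterate_succ_snd (F : E → E) (δ : ℝ) (x₀ : E) (k : ℕ) :
    (acceleratedIterate F δ x₀ (k + 1)).2 = (acceleratedIterate F δ x₀ (k + 1)).1
      + ((k : ℝ) / (k + 3)) • ((acceleratedIterate F δ x₀ (k + 1)).1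
        - (acceleratedIterate F δ x₀ k).1) := by
  have : (((k + 1 : ℕ) : ℝ) - 1) / (((k + 1 : ℕ) : ℝ) + 2) = (k : ℝ) / (k + 3) := by
    push_cast
    congr 1 <;> ring
  rw [← this]
  rfl

/-- The weight `t (t + h) (t + 2 h)` at the time `t = k h`. -/
def timeWeight (h : ℝ) (k : ℕ) : ℝ := (k * h) * (k * h + h) * (k * h + 2 * h)

theorem timeWeight_nonneg {h : ℝ} (hh : 0 ≤ h) (k : ℕ) : 0 ≤ timeWeight h k := by
  unfold timeWeight; positivity

theorem cube_le_timeWeight {h : ℝ} (hh : 0 ≤ h) (k : ℕ) : (k * h) ^ 3 ≤ timeWeight h k := by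
  unfold timeWeight
  have h1 : 0 ≤ (k : ℝ) * h := by positivity
  nlinarith [mul_nonneg h1 hh, mul_nonneg h1 h1, mul_nonneg (mul_nonneg h1 h1) hh,
    mul_nonneg (mul_nonneg h1 hh) hh]

theorem timeWeight_mono {h : ℝ} (hh : 0 ≤ h) : Monotone (timeWeight h) := by
  intro i j hij
  unfold timeWeight
  have : (i : ℝ) ≤ j := by exact_mod_cast hij
  gcongr

/-- The momentum coefficient `k / (k + 3)` is exactly the ratio of two consecutive weights, so the
weighted increments telescope. This is the discrete form of `(t³ Y')' = -t³ f`. -/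
theorem timeWeight_succ_smul_sub (F : E → E) (h : ℝ) (x₀ : E) (k : ℕ) :
    timeWeight h (k + 1) • ((acceleratedIterate F (h ^ 2) x₀ (k + 2)).1
        - (acceleratedIterate F (h ^ 2) x₀ (k + 1)).1)
      = timeWeight h k • ((acceleratedIterate F (h ^ 2) x₀ (k + 1)).1
          - (acceleratedIterate F (h ^ 2) x₀ k).1)
        - (h ^ 2 * timeWeight h (k + 1)) • F (acceleratedIterate F (h ^ 2) x₀ (k + 1)).2 := by
  have hw : timeWeight h (k + 1) * ((k : ℝ) / (k + 3)) = timeWeight h k := by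
    unfold timeWeight
    push_cast
    field_simp
    ring
  rw [acceleratedIterate_succ_fst F (h ^ 2) x₀ (k + 1)]
  nth_rewrite 1 [acceleratedIterate_succ_snd]
  rw [← hw, mul_smul, mul_comm (h ^ 2), mul_smul, ← smul_sub]
  congr 1
  abel

namespace IsApproxSolution

variable [CompleteSpace E] {T L B η : ℝ} {F : E → E} {G Y : ℝ → E} {y₀ : E}

/-- By telescoping, the weighted increment is a Riemann sum for `-h ∫ s³ G`. The sum of errors
starts at the query point of index `1`, because the weight vanishes at index `0`. -/
theorem norm_weighted_increment_le (H : IsApproxSolution accelerated T L B η F G Y y₀)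
    (hL : 0 ≤ L) (hB : 0 ≤ B) {h : ℝ} (hh : 0 < h) (x₀ : E) (k : ℕ) (hk : k * h ≤ T) :
    ‖(h • ∫ s in (0 : ℝ)..(k * h), s ^ 3 • G s)
        + timeWeight h k • ((acceleratedIterate F (h ^ 2) x₀ (k + 1)).1
          - (acceleratedIterate F (h ^ 2) x₀ k).1)‖
      ≤ h * (6 * B * h * (k * h) ^ 3
        + timeWeight h k * (k * h * (η + L * (max 1 T * B) * h)
          + L * h * ∑ j ∈ Finset.range k,
            ‖(acceleratedIterate F (h ^ 2) x₀ (j + 1)).2 - Y ((j + 1 : ℕ) * h)‖)) := by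
  have hT : 0 ≤ T := le_trans (by positivity) hk
  induction k with
  | zero => simp [timeWeight]
  | succ k ih =>
    have hle : (k : ℝ) * h ≤ (k + 1 : ℕ) * h := by push_cast; nlinarith
    have hk0 : 0 ≤ (k : ℝ) * h := by positivity
    have ih' := ih (hle.trans hk)
    set y := (acceleratedIterate F (h ^ 2) x₀ (k + 1)).2 with hy
    set τ := ((k + 1 : ℕ) : ℝ) * h with hτ
    have hτk : τ = k * h + h := by rw [hτ]; push_cast; ring
    set W := timeWeight h (k + 1) with hW
    have hW0 : 0 ≤ W := timeWeight_nonneg hh.le _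
    set c := η + L * (max 1 T * B) * h with hc
    have hcG : Continuous fun s => s ^ 3 • G s := by
      have := H.continuous
      fun_prop
    have hc0 : 0 ≤ c := by
      have h0 : (0 : ℝ) ∈ Icc 0 T := ⟨le_rfl, hT⟩
      have := (norm_nonneg _).trans (H.residual 0 h0)
      positivity
    set S := ∑ j ∈ Finset.range k,
            ‖(acceleratedIterate F (h ^ 2) x₀ (j + 1)).2 - Y ((j + 1 : ℕ) * h)‖ with hS
    have hS0 : 0 ≤ S := Finset.sum_nonneg fun _ _ => norm_nonneg _
    have hint : ‖∫ s in (k * h : ℝ)..τ, (s ^ 3 • G s - W • F y)‖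
        ≤ (6 * τ ^ 2 * h * B + W * (c + L * ‖y - Y τ‖)) * h := by
      have h1 := intervalIntegral.norm_integral_le_of_norm_le_const (a := k * h)
        (b := τ) (f := fun s => s ^ 3 • G s - W • F y)
        (C := 6 * τ ^ 2 * h * B + W * (c + L * ‖y - Y τ‖)) fun s hs => by
          rw [uIoc_of_le hle] at hs
          have hsT : s ∈ Icc 0 T := ⟨hk0.trans hs.1.le, hs.2.trans hk⟩
          have h2 : ‖G s - F y‖ ≤ c + L * ‖y - Y τ‖ := by
            refine H.norm_field_sub_le hL hsT ⟨hk0.trans hle, hk⟩ hB ?_ y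
            rw [abs_of_nonneg (by linarith [hs.2])]
            have := hs.1
            linarith
          have h3 : s ^ 3 ≤ W := by
            refine (pow_le_pow_left₀ hsT.1 hs.2 3).trans ?_
            exact cube_le_timeWeight hh.le (k + 1)
          -- Since `s ≥ τ - h`, the difference is at most `τ (τ + h) (τ + 2h) - (τ - h)³ = 6 τ² h -
          -- h² (τ - h)`.
          have h4 : W - s ^ 3 ≤ 6 * τ ^ 2 * h := by
            have h5 : (k * h) ^ 3 ≤ s ^ 3 := pow_le_pow_left₀ hk0 hs.1.le 3
            have h6 : W = τ * (τ + h) * (τ + 2 * h) := rfl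
            have h7 : (k : ℝ) * h = τ - h := by linarith
            rw [h7] at h5 hk0
            rw [h6]
            nlinarith [mul_nonneg hk0 (sq_nonneg h)]
          have h8 : s ^ 3 • G s - W • F y = -((W - s ^ 3) • G s) + W • (G s - F y) := by
            rw [sub_smul, smul_sub]; abel
          rw [h8]
          refine (norm_add_le _ _).trans (add_le_add ?_ ?_)
          · rw [norm_neg, norm_smul, Real.norm_of_nonneg (sub_nonneg.2 h3)]
            exact mul_le_mul h4 (H.norm_le s hsT) (norm_nonneg _) (by positivity)
          · rw [norm_smul, Real.norm_of_nonneg hW0]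
            exact mul_le_mul_of_nonneg_left h2 hW0
      rwa [show τ - k * h = h by rw [hτk]; ring, abs_of_pos hh] at h1
    have hsplit : (h • ∫ s in (0 : ℝ)..τ, s ^ 3 • G s)
        + W • ((acceleratedIterate F (h ^ 2) x₀ (k + 2)).1
          - (acceleratedIterate F (h ^ 2) x₀ (k + 1)).1)
        = ((h • ∫ s in (0 : ℝ)..(k * h), s ^ 3 • G s)
        + timeWeight h k • ((acceleratedIterate F (h ^ 2) x₀ (k + 1)).1
          - (acceleratedIterate F (h ^ 2) x₀ k).1))
        + h • ∫ s in (k * h : ℝ)..τ, (s ^ 3 • G s - W • F y) := by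
      rw [timeWeight_succ_smul_sub, ← intervalIntegral.integral_add_adjacent_intervals
        (hcG.intervalIntegrable 0 (k * h)) (hcG.intervalIntegrable (k * h) τ),
        intervalIntegral.integral_sub (hcG.intervalIntegrable _ _) (by simp),
        intervalIntegral.integral_const, show τ - k * h = h by rw [hτk]; ring]
      simp only [smul_add, smul_sub, smul_smul, ← hW, ← hy]
      rw [show h * (h * W) = h ^ 2 * W by ring]
      abel
    rw [hsplit, Finset.sum_range_succ, ← hS]
    refine (norm_add_le _ _).trans ?_
    rw [norm_smul, Real.norm_of_nonneg hh.le]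
    refine (add_le_add ih' (mul_le_mul_of_nonneg_left hint hh.le)).trans ?_
    rw [← mul_add]
    refine mul_le_mul_of_nonneg_left ?_ hh.le
    have hWk : timeWeight h k ≤ W := timeWeight_mono hh.le (Nat.le_succ k)
    have h1 : timeWeight h k * (k * h * c + L * h * S) ≤ W * (k * h * c + L * h * S) :=
      mul_le_mul_of_nonneg_right hWk (by positivity)
    have h2 : 6 * B * h * (k * h) ^ 3 + 6 * τ ^ 2 * h * B * h ≤ 6 * B * h * τ ^ 3 := by
      have h7 : (k : ℝ) * h = τ - h := by linarith
      rw [h7] at hk0 ⊢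
      have : (τ - h) ^ 3 + τ ^ 2 * h ≤ τ ^ 3 := by
        nlinarith [mul_nonneg hk0 (sq_nonneg h), mul_nonneg (mul_nonneg hk0 hk0) hh.le]
      have := mul_le_mul_of_nonneg_left this (by positivity : 0 ≤ 6 * B * h)
      linarith
    have h3 : τ * c = k * h * c + h * c := by rw [hτk]; ring
    rw [h3]
    nlinarith

/-- Dividing the weighted estimate by the weight shows that the increment is `-h` times the velocity
at any time of the same grid interval, up to an error with an additional small factor. Replacing
`r³` by the weight costs only a relative error of order `h / t`, which the factor `r` in the bound
of the velocity compensates. -/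
theorem norm_increment_add_velocity_le (H : IsApproxSolution accelerated T L B η F G Y y₀)
    (hL : 0 ≤ L) (hB : 0 ≤ B) {h : ℝ} (hh : 0 < h) (hh1 : h ≤ 1) (x₀ : E) (k : ℕ) {r : ℝ}
    (hr : r ∈ Icc (k * h) ((k + 1 : ℕ) * h)) (hrT : r ≤ T) :
    ‖((acceleratedIterate F (h ^ 2) x₀ (k + 1)).1 - (acceleratedIterate F (h ^ 2) x₀ k).1)
        + h • velocity accelerated G r‖
      ≤ h * (28 * B * h + (T + 1) * (η + L * (max 1 T * B) * h)
        + L * h * ∑ j ∈ Finset.range (k + 1),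
            ‖(acceleratedIterate F (h ^ 2) x₀ j).2 - Y (j * h)‖) := by
  have hk0 : 0 ≤ (k : ℝ) * h := by positivity
  have hr0 : 0 ≤ r := hk0.trans hr.1
  have hT : 0 ≤ T := hr0.trans hrT
  have h0T : (0 : ℝ) ∈ Icc 0 T := ⟨le_rfl, hT⟩
  have hη : 0 ≤ η := (norm_nonneg _).trans (H.residual 0 h0T)
  set c := η + L * (max 1 T * B) * h with hc
  have hc0 : 0 ≤ c := by positivity
  have hvel : ‖velocity accelerated G r‖ ≤ r * B := by
    have := norm_velocity_accelerated_le (f := G) (r := r) (c := B) fun s hs => by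
      rw [uIcc_of_le hr0] at hs
      exact H.norm_le s ⟨hs.1, hs.2.trans hrT⟩
    rwa [abs_of_nonneg hr0] at this
  -- For `k = 0` the weight is zero and the weighted estimate is empty; the first increment is `-h²
  -- F(x₀)`, and the velocity is at most `h B`.
  rcases Nat.eq_zero_or_pos k with rfl | hkpos
  · have hr1 : r ≤ h := by simpa using hr.2
    have hY0 : Y 0 = y₀ := by rw [H.eq 0 h0T]; simp [displacement]
    have hF : ‖F x₀‖ ≤ B + η + L * ‖x₀ - Y 0‖ := by
      have h1 := norm_add_le (F (Y 0)) (F x₀ - F (Y 0))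
      have h2 := norm_sub_le (G 0) (G 0 - F (Y 0))
      rw [add_sub_cancel] at h1
      rw [sub_sub_cancel] at h2
      linarith [H.norm_le 0 h0T, H.residual 0 h0T, H.lipschitz x₀ (Y 0)]
    have h1 : (acceleratedIterate F (h ^ 2) x₀ (0 + 1)).1 - (acceleratedIterate F (h ^ 2) x₀ 0).1
        = -(h ^ 2 • F x₀) := by simp [acceleratedIterate]
    rw [h1]
    refine (norm_add_le _ _).trans ?_
    rw [norm_neg, norm_smul, norm_smul, Real.norm_of_nonneg hh.le,
      Real.norm_of_nonneg (sq_nonneg h), pow_two, mul_assoc, ← mul_add]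
    refine mul_le_mul_of_nonneg_left ?_ hh.le
    have h2 : (acceleratedIterate F (h * h) x₀ 0).2 = x₀ := rfl
    simp only [zero_add, Finset.range_one, Finset.sum_singleton, h2, Nat.cast_zero, zero_mul]
    have h3 := mul_le_mul_of_nonneg_left hF hh.le
    have h4 : r * B ≤ h * B := mul_le_mul_of_nonneg_right hr1 hB
    have h5 : h * η ≤ 1 * η := mul_le_mul_of_nonneg_right hh1 hη
    have h6 : 0 ≤ L * (max 1 T * B) * h := by positivity
    have h7 : 0 ≤ T * c := by positivity
    have h8 : 0 ≤ B * h := by positivity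
    linarith
  · set d := (acceleratedIterate F (h ^ 2) x₀ (k + 1)).1 - (acceleratedIterate F (h ^ 2) x₀ k).1
      with hd
    set t := (k : ℝ) * h with ht
    have ht0 : 0 < t := by positivity
    have hht : h ≤ t := by
      rw [ht]
      exact le_mul_of_one_le_left hh.le (by exact_mod_cast hkpos)
    set W := timeWeight h k with hW
    have htW : t ^ 3 ≤ W := cube_le_timeWeight hh.le k
    have hW0 : 0 < W := lt_of_lt_of_le (by positivity) htW
    have hkey := H.norm_weighted_increment_le hL hB hh x₀ k (hr.1.trans hrT)
    rw [← hd, ← hW, ← ht, ← hc] at hkey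
    set S := ∑ j ∈ Finset.range k,
            ‖(acceleratedIterate F (h ^ 2) x₀ (j + 1)).2 - Y ((j + 1 : ℕ) * h)‖ with hS
    have hSle : S ≤ ∑ j ∈ Finset.range (k + 1),
            ‖(acceleratedIterate F (h ^ 2) x₀ j).2 - Y (j * h)‖ := by
      rw [Finset.sum_range_succ']
      exact le_add_of_nonneg_right (norm_nonneg _)
    set S' := ∑ j ∈ Finset.range (k + 1),
            ‖(acceleratedIterate F (h ^ 2) x₀ j).2 - Y (j * h)‖ with hS'
    have hrt : r ≤ t + h := by
      refine hr.2.trans (le_of_eq ?_)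
      rw [ht]; push_cast; ring
    have hcG : Continuous fun s => s ^ 3 • G s := by
      have := H.continuous
      fun_prop
    have hr3 : r ^ 3 ≤ 8 * t ^ 3 := by
      calc r ^ 3 ≤ (2 * t) ^ 3 := pow_le_pow_left₀ hr0 (by linarith) 3
        _ = 8 * t ^ 3 := by ring
    have hI : ‖∫ s in t..r, s ^ 3 • G s‖ ≤ 8 * t ^ 3 * B * h := by
      have h1 := intervalIntegral.norm_integral_le_of_norm_le_const (a := t)
        (b := r) (f := fun s => s ^ 3 • G s) (C := 8 * t ^ 3 * B) fun s hs => by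
          rw [uIoc_of_le hr.1] at hs
          have hs0 : 0 ≤ s := ht0.le.trans hs.1.le
          rw [norm_smul, norm_pow, Real.norm_of_nonneg hs0]
          exact mul_le_mul ((pow_le_pow_left₀ hs0 hs.2 3).trans hr3)
            (H.norm_le s ⟨hs0, hs.2.trans hrT⟩) (norm_nonneg _) (by positivity)
      refine h1.trans (mul_le_mul_of_nonneg_left ?_ (by positivity))
      rw [abs_of_nonneg (by linarith [hr.1])]
      linarith
    have hWr : |W - r ^ 3| ≤ 7 * t ^ 2 * h := by
      have h1 : W = t * (t + h) * (t + 2 * h) := rfl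
      have h2 : t ^ 3 ≤ r ^ 3 := pow_le_pow_left₀ ht0.le hr.1 3
      have h3 : r ^ 3 ≤ (t + h) ^ 3 := pow_le_pow_left₀ hr0 hrt 3
      have h4 : t * h * h ≤ t * t * h := by
        have := mul_le_mul_of_nonneg_left hht (by positivity : 0 ≤ t * h)
        linarith
      have h5 : h * h * h ≤ t * t * h :=
        mul_le_mul_of_nonneg_right (mul_le_mul hht hht hh.le ht0.le) hh.le
      rw [abs_le]
      constructor <;> nlinarith
    have hvelr : r ^ 3 • velocity accelerated G r = ∫ s in (0 : ℝ)..r, s ^ 3 • G s := by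
      have : 0 < r := ht0.trans_le hr.1
      rw [velocity, smul_smul, mul_inv_cancel₀ (by positivity), one_smul]
    have hdecomp : W • (d + h • velocity accelerated G r)
        = ((h • ∫ s in (0 : ℝ)..t, s ^ 3 • G s) + W • d)
          + h • ((W - r ^ 3) • velocity accelerated G r + ∫ s in t..r, s ^ 3 • G s) := by
      rw [sub_smul, hvelr, ← intervalIntegral.integral_add_adjacent_intervals
        (hcG.intervalIntegrable 0 t) (hcG.intervalIntegrable t r), smul_add W, smul_comm W h]
      simp only [smul_add, smul_sub]
      abel
    have hbound : W * ‖d + h • velocity accelerated G r‖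
        ≤ W * (h * (28 * B * h + (T + 1) * c + L * h * S')) := by
      rw [← Real.norm_of_nonneg hW0.le, ← norm_smul, hdecomp, Real.norm_of_nonneg hW0.le]
      -- The constant is `22 = 7 · 2 + 8`: replacing `r³` by the weight, and the integral from `t`
      -- to `r`. With the `6` of the weighted estimate it makes `28`.
      refine (norm_add_le _ _).trans ((add_le_add hkey (b := _) (d := h * (22 * t ^ 3 * B * h))
        ?_).trans ?_)
      · rw [norm_smul, Real.norm_of_nonneg hh.le]
        refine mul_le_mul_of_nonneg_left ((norm_add_le _ _).trans ?_) hh.le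
        rw [norm_smul, Real.norm_eq_abs]
        have h1 : |W - r ^ 3| * ‖velocity accelerated G r‖ ≤ 7 * t ^ 2 * h * (2 * t * B) :=
          mul_le_mul hWr (hvel.trans (mul_le_mul_of_nonneg_right (by linarith) hB))
            (norm_nonneg _) (by positivity)
        calc _ ≤ 7 * t ^ 2 * h * (2 * t * B) + 8 * t ^ 3 * B * h := add_le_add h1 hI
          _ = _ := by ring
      · have h1 : 28 * B * h * t ^ 3 ≤ W * (28 * B * h) := by
          rw [mul_comm W]
          exact mul_le_mul_of_nonneg_left htW (by positivity)
        have h2 : W * (t * c + L * h * S) ≤ W * ((T + 1) * c + L * h * S') := by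
          refine mul_le_mul_of_nonneg_left (add_le_add ?_ ?_) hW0.le
          · exact mul_le_mul_of_nonneg_right (by linarith [hr.1]) hc0
          · exact mul_le_mul_of_nonneg_left hSle (by positivity)
        have h3 : 6 * B * h * t ^ 3 + W * (t * c + L * h * S) + 22 * t ^ 3 * B * h
          ≤ W * (28 * B * h + (T + 1) * c + L * h * S') := by linarith
        have := mul_le_mul_of_nonneg_left h3 hh.le
        linarith
    exact le_of_mul_le_mul_left hbound hW0

end IsApproxSolution
end DescentMethod

end

/-! ### The error bound for both methods, with a globally Lipschitz field -/

noncomputable section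

namespace DescentMethod

variable {E : Type*} [NormedAddCommGroup E] [NormedSpace ℝ E]

theorem timeStep_pos (a : DescentMethod) {δ : ℝ} (hδ : 0 < δ) : 0 < a.timeStep δ := by
  cases a
  · exact hδ
  · exact Real.sqrt_pos.2 hδ

theorem timeStep_le_sqrt (a : DescentMethod) {δ : ℝ} (hδ : 0 < δ) (hδ1 : δ ≤ 1) :
    a.timeStep δ ≤ √δ := by
  cases a
  · exact Real.le_sqrt_of_sq_le (by simp only [timeStep]; nlinarith)
  · exact le_rfl

/-- If the points at which the method evaluates the field lie in a set on which two fields agree,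
then the two fields produce the same iterates. -/
theorem iterate_congr (a : DescentMethod) {F F' : E → E} {δ : ℝ} {x₀ : E} {Θ : Set E} {K : ℕ}
    (hF : EqOn F F' Θ) (hq : ∀ k < K, a.query F δ x₀ k ∈ Θ) :
    ∀ k ≤ K, a.iterate F δ x₀ k = a.iterate F' δ x₀ k := by
  cases a
  · intro k
    induction k with
    | zero => intro _; rfl
    | succ k ih =>
      intro hk
      have h1 := ih (by omega)
      have h2 := hF (hq k (by omega))
      simp only [iterate, query] at h1 h2 ⊢
      rw [plainIterate, plainIterate, ← h1, h2]
  · have h : ∀ k ≤ K, acceleratedIterate F δ x₀ k = acceleratedIterate F' δ x₀ k := by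
      intro k
      induction k with
      | zero => intro _; rfl
      | succ k ih =>
        intro hk
        have h1 := ih (by omega)
        have h2 := hF (hq k (by omega))
        simp only [query] at h2
        simp only [acceleratedIterate]
        rw [← h1, h2]
    intro k hk
    simp only [iterate, h k hk]

namespace IsApproxSolution

variable [CompleteSpace E] {a : DescentMethod} {T L B η : ℝ} {F : E → E} {G Y : ℝ → E} {y₀ : E}

/-- The estimate of the increment holds for every `r` in the grid interval. Integrated over `r`, the
velocity becomes the exact increment of `-Y`, so the errors of the increments just add up. -/
theorem acceleratedIterate_le (H : IsApproxSolution accelerated T L B η F G Y y₀) (hL : 0 ≤ L)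
    (hB : 0 ≤ B) {h : ℝ} (hh : 0 < h) (hh1 : h ≤ 1) (x₀ : E) (k : ℕ) (hk : k * h ≤ T) :
    ‖(acceleratedIterate F (h ^ 2) x₀ k).1 - Y (k * h)‖ ≤ ‖x₀ - y₀‖ + k * h *
      (28 * B * h + (T + 1) * (η + L * (max 1 T * B) * h)
        + L * h * ∑ j ∈ Finset.range k, ‖(acceleratedIterate F (h ^ 2) x₀ j).2 - Y (j * h)‖) := by
  have hT : 0 ≤ T := le_trans (by positivity) hk
  have hcV : Continuous (velocity accelerated G) := continuous_velocity accelerated H.continuous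
  induction k with
  | zero =>
    have : Y 0 = y₀ := by rw [H.eq 0 ⟨le_rfl, hT⟩]; simp [displacement]
    simp [acceleratedIterate, this]
  | succ k ih =>
    have hle : (k : ℝ) * h ≤ (k + 1 : ℕ) * h := by push_cast; nlinarith
    have hk0 : 0 ≤ (k : ℝ) * h := by positivity
    have ih' := ih (hle.trans hk)
    have hτ : ((k + 1 : ℕ) : ℝ) * h - k * h = h := by push_cast; ring
    set d := (acceleratedIterate F (h ^ 2) x₀ (k + 1)).1 - (acceleratedIterate F (h ^ 2) x₀ k).1
      with hd
    set c := fun j : ℕ => ‖(acceleratedIterate F (h ^ 2) x₀ j).2 - Y (j * h)‖ with hc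
    set α := 28 * B * h + (T + 1) * (η + L * (max 1 T * B) * h) with hα
    set R := α + L * h * ∑ j ∈ Finset.range (k + 1), c j with hR
    have hint : ‖∫ r in (k * h : ℝ)..((k + 1 : ℕ) * h), (d + h • velocity accelerated G r)‖
        ≤ h * R * h := by
      have h1 := intervalIntegral.norm_integral_le_of_norm_le_const (a := k * h)
        (b := (k + 1 : ℕ) * h) (f := fun r => d + h • velocity accelerated G r)
        (C := h * R) fun r hr => by
          rw [uIoc_of_le hle] at hr
          exact H.norm_increment_add_velocity_le hL hB hh hh1 x₀ k ⟨hr.1.le, hr.2⟩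
            (hr.2.trans hk)
      rwa [hτ, abs_of_pos hh] at h1
    have heq : ∫ r in (k * h : ℝ)..((k + 1 : ℕ) * h), (d + h • velocity accelerated G r)
        = h • (d - (Y ((k + 1 : ℕ) * h) - Y (k * h))) := by
      rw [intervalIntegral.integral_add (intervalIntegrable_const)
        ((by fun_prop : Continuous fun r => h • velocity accelerated G r).intervalIntegrable _ _),
        intervalIntegral.integral_const, intervalIntegral.integral_smul, hτ,
        H.eq _ ⟨hk0, hle.trans hk⟩, H.eq _ ⟨hk0.trans hle, hk⟩,
        ← displacement_sub accelerated H.continuous, ← smul_add]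
      congr 1
      abel
    rw [heq, norm_smul, Real.norm_of_nonneg hh.le, mul_assoc] at hint
    have hinc := le_of_mul_le_mul_left hint hh
    have hsplit : (acceleratedIterate F (h ^ 2) x₀ (k + 1)).1 - Y ((k + 1 : ℕ) * h)
        = ((acceleratedIterate F (h ^ 2) x₀ k).1 - Y (k * h))
          + (d - (Y ((k + 1 : ℕ) * h) - Y (k * h))) := by
      rw [hd]; abel
    rw [hsplit]
    refine (norm_add_le _ _).trans ((add_le_add ih' hinc).trans ?_)
    have hmono : α + L * h * ∑ j ∈ Finset.range k, c j ≤ R := by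
      rw [hR, Finset.sum_range_succ]
      have : 0 ≤ L * h * c k := by positivity
      linarith
    have h2 := mul_le_mul_of_nonneg_left hmono hk0
    push_cast
    linarith

/-- The explicit constant in the bound for the discretization error. -/
def errorConst (T L B : ℝ) : ℝ :=
  1 + max 1 T * B + (T + 1) * (28 * B + (T + 1) * (1 + L * (max 1 T * B)))

/-- The recursion closes on the query points, where the field is evaluated, so their errors must be
bounded too. In the accelerated method a query differs from the iterate by at most the last
increment, as the momentum coefficient is at most `1`; this turns the factor `T` into `T + 1`. -/
theorem iterate_query_le (H : IsApproxSolution a T L B η F G Y y₀) (hL : 0 ≤ L) (hB : 0 ≤ B)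
    {δ : ℝ} (hδ : 0 < δ) (hδ1 : δ ≤ 1) (x₀ : E) (k : ℕ) (hk : k * a.timeStep δ ≤ T) :
    max ‖a.iterate F δ x₀ k - Y (k * a.timeStep δ)‖ ‖a.query F δ x₀ k - Y (k * a.timeStep δ)‖
      ≤ errorConst T L B * (√δ + ‖x₀ - y₀‖ + η) + (T + 1) * L * a.timeStep δ *
        ∑ j ∈ Finset.range k, ‖a.query F δ x₀ j - Y (j * a.timeStep δ)‖ := by
  set h := a.timeStep δ with hh_def
  have hh : 0 < h := a.timeStep_pos hδ
  have hhδ : h ≤ √δ := a.timeStep_le_sqrt hδ hδ1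
  have hh1 : h ≤ 1 := hhδ.trans (Real.sqrt_le_one.2 hδ1)
  have hk0 : 0 ≤ (k : ℝ) * h := by positivity
  have hT : 0 ≤ T := hk0.trans hk
  have h0T : (0 : ℝ) ∈ Icc 0 T := ⟨le_rfl, hT⟩
  have hη : 0 ≤ η := (norm_nonneg _).trans (H.residual 0 h0T)
  set κ := max 1 T with hκ
  have hκ0 : 0 < κ := lt_of_lt_of_le one_pos (le_max_left _ _)
  set e := ‖x₀ - y₀‖ with he
  have he0 : 0 ≤ e := norm_nonneg _
  have hconst : e + κ * B * h + (T + 1) * (28 * B * h + (T + 1) * (η + L * (κ * B) * h))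
      ≤ errorConst T L B * (√δ + e + η) := by
    set A1 := κ * B + (T + 1) * (28 * B + (T + 1) * (L * (κ * B))) with hA1
    have hA10 : 0 ≤ A1 := by positivity
    have h1 : A1 * h ≤ A1 * √δ := mul_le_mul_of_nonneg_left hhδ hA10
    have h2 : errorConst T L B = 1 + (T + 1) ^ 2 + A1 := by
      rw [errorConst, hA1]; ring
    rw [h2]
    have h3 : 0 ≤ √δ := Real.sqrt_nonneg δ
    have h4 : 0 ≤ A1 * e := by positivity
    have h5 : 0 ≤ A1 * η := by positivity
    have h6 : 0 ≤ (T + 1) ^ 2 * e := by positivity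
    have h7 : 0 ≤ (T + 1) ^ 2 * √δ := by positivity
    have h8 : e + κ * B * h + (T + 1) * (28 * B * h + (T + 1) * (η + L * (κ * B) * h))
      = e + (T + 1) ^ 2 * η + A1 * h := by rw [hA1]; ring
    rw [h8]
    linarith
  refine le_trans ?_ (add_le_add_left hconst _)
  have hY0 : Y 0 = y₀ := by rw [H.eq 0 h0T]; simp [displacement]
  cases a
  · have hδh : δ = h := rfl
    simp only [iterate, query, max_self]
    rw [hδh]
    have h1 := H.plainIterate_le hL hB hh x₀ k hk
    set S := ∑ j ∈ Finset.range k, ‖plainIterate F h x₀ j - Y (j * h)‖ with hS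
    have hS0 : 0 ≤ S := Finset.sum_nonneg fun _ _ => norm_nonneg _
    set c := η + L * (κ * B) * h with hc
    have hc0 : 0 ≤ c := by positivity
    have h2 : k * h * c ≤ (T + 1) * ((T + 1) * c) := by
      have : k * h * c ≤ T * c := mul_le_mul_of_nonneg_right hk hc0
      have : 0 ≤ (T ^ 2 + T + 1) * c := by positivity
      linarith
    have h3 : 0 ≤ T * (L * h * S) := by positivity
    have h4 : 0 ≤ κ * B * h := by positivity
    have h5 : 0 ≤ (T + 1) * (28 * B * h) := by positivity
    linarith
  · have hδh : δ = h ^ 2 := (Real.sq_sqrt hδ.le).symm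
    simp only [iterate, query]
    rw [hδh]
    set c := η + L * (κ * B) * h with hc
    have hc0 : 0 ≤ c := by positivity
    have hfst : ∀ k : ℕ, k * h ≤ T → ‖(acceleratedIterate F (h ^ 2) x₀ k).1 - Y (k * h)‖
        ≤ e + T * (28 * B * h + (T + 1) * c + L * h * ∑ j ∈ Finset.range k,
          ‖(acceleratedIterate F (h ^ 2) x₀ j).2 - Y (j * h)‖) := fun k hk => by
      refine (H.acceleratedIterate_le hL hB hh hh1 x₀ k hk).trans (add_le_add_right ?_ _)
      exact mul_le_mul_of_nonneg_right hk (by positivity)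
    rcases k with _ | k
    · have h1 : 0 ≤ κ * B * h + (T + 1) * (28 * B * h + (T + 1) * c) := by positivity
      simp only [acceleratedIterate, Nat.cast_zero, zero_mul, hY0, max_self, Finset.range_zero,
        Finset.sum_empty, mul_zero]
      linarith
    · set S := ∑ j ∈ Finset.range (k + 1), ‖(acceleratedIterate F (h ^ 2) x₀ j).2 - Y (j * h)‖
        with hS
      have hS0 : 0 ≤ S := Finset.sum_nonneg fun _ _ => norm_nonneg _
      set Q := 28 * B * h + (T + 1) * c + L * h * S with hQ
      have hQ0 : 0 ≤ Q := by positivity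
      have h1 : ‖(acceleratedIterate F (h ^ 2) x₀ (k + 1)).1 - Y ((k + 1 : ℕ) * h)‖
        ≤ e + T * Q := hfst (k + 1) hk
      set d := (acceleratedIterate F (h ^ 2) x₀ (k + 1)).1 - (acceleratedIterate F (h ^ 2) x₀ k).1
        with hd
      have hle : (k : ℝ) * h ≤ (k + 1 : ℕ) * h := by push_cast; nlinarith
      have hkT : (k : ℝ) * h ∈ Icc 0 T := ⟨by positivity, hle.trans hk⟩
      have h2 : ‖d‖ ≤ h * Q + h * (κ * B) := by
        have h3 := H.norm_increment_add_velocity_le hL hB hh hh1 x₀ k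
          (left_mem_Icc.2 hle) hkT.2
        have h4 : ‖velocity accelerated G (k * h)‖ ≤ κ * B :=
          norm_velocity_le_of_le accelerated hkT fun s hs => H.norm_le s ⟨hs.1, hs.2.trans hkT.2⟩
        have h5 := norm_sub_le (d + h • velocity accelerated G (k * h))
          (h • velocity accelerated G (k * h))
        rw [add_sub_cancel_right, norm_smul, Real.norm_of_nonneg hh.le] at h5
        exact h5.trans (add_le_add h3 (mul_le_mul_of_nonneg_left h4 hh.le))
      have h6 : h * Q ≤ 1 * Q := mul_le_mul_of_nonneg_right hh1 hQ0
      have h7 : ‖(acceleratedIterate F (h ^ 2) x₀ (k + 1)).2 - Y ((k + 1 : ℕ) * h)‖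
          ≤ e + T * Q + (h * Q + h * (κ * B)) := by
        rw [acceleratedIterate_succ_snd, add_sub_right_comm]
        refine (norm_add_le _ _).trans (add_le_add h1 ?_)
        rw [norm_smul, Real.norm_of_nonneg (by positivity)]
        refine (mul_le_of_le_one_left (norm_nonneg _) ?_).trans h2
        rw [div_le_one (by positivity)]
        linarith
      have h8 : e + κ * B * h + (T + 1) * (28 * B * h + (T + 1) * c) + (T + 1) * L * h * S
        = e + κ * B * h + (T + 1) * Q := by rw [hQ]; ring
      rw [h8]
      have h9 : 0 ≤ κ * B * h := by positivity
      refine max_le ?_ ?_ <;> linarith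

end IsApproxSolution

/-- The discretization error of both methods: the iterates stay close to any path that solves
approximately the differential equation of the method. -/
theorem exists_discretization_bound (E : Type*) [NormedAddCommGroup E] [NormedSpace ℝ E]
    [CompleteSpace E] {T L B : ℝ} (hT : 0 ≤ T) (hL : 0 ≤ L) (hB : 0 ≤ B) :
    ∃ M : ℝ, 0 < M ∧ ∀ (a : DescentMethod) (η : ℝ) (F : E → E) (G Y : ℝ → E) (y₀ : E),
      IsApproxSolution a T L B η F G Y y₀ → ∀ (x₀ : E) (δ : ℝ), 0 < δ → δ ≤ 1 →
        (∀ t ∈ Icc 0 T, ‖stepFun (a.timeStep δ) (a.iterate F δ x₀) t - Y t‖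
          ≤ M * (√δ + ‖x₀ - y₀‖ + η)) ∧
        ∀ k : ℕ, k * a.timeStep δ ≤ T →
          ‖a.query F δ x₀ k - Y (k * a.timeStep δ)‖ ≤ M * (√δ + ‖x₀ - y₀‖ + η) := by
  set C := IsApproxSolution.errorConst T L B with hC
  have hC0 : 0 < C := by unfold IsApproxSolution.errorConst at hC; rw [hC]; positivity
  set M := C * Real.exp ((T + 1) * L * T) with hM
  have hM0 : 0 < M := by positivity
  -- `M` is the Gronwall constant at the grid points; the second summand covers the motion of `Y`
  -- within one time step.
  refine ⟨M + max 1 T * B, by positivity, fun a η F G Y y₀ H x₀ δ hδ hδ1 => ?_⟩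
  set h := a.timeStep δ with hh_def
  have hh : 0 < h := a.timeStep_pos hδ
  have hhδ : h ≤ √δ := a.timeStep_le_sqrt hδ hδ1
  have h0T : (0 : ℝ) ∈ Icc 0 T := ⟨le_rfl, hT⟩
  have hη : 0 ≤ η := (norm_nonneg _).trans (H.residual 0 h0T)
  set D := √δ + ‖x₀ - y₀‖ + η with hD
  have hDδ : √δ ≤ D := by
    have := norm_nonneg (x₀ - y₀)
    linarith
  have hD0 : 0 ≤ D := (Real.sqrt_nonneg δ).trans hDδ
  have hboth : ∀ k : ℕ, k * h ≤ T →
      max ‖a.iterate F δ x₀ k - Y (k * h)‖ ‖a.query F δ x₀ k - Y (k * h)‖ ≤ M * D := by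
    intro k hk
    have hmain : ∀ j ≤ k, _ := fun j hj => H.iterate_query_le hL hB hδ hδ1 x₀ j
      (le_trans (mul_le_mul_of_nonneg_right (by exact_mod_cast hj) hh.le) hk)
    refine (hmain k le_rfl).trans ?_
    refine (add_mul_sum_range_le_mul_exp (by positivity) (by positivity) k
      fun j hj => (le_max_right _ _).trans (hmain j hj)).trans ?_
    rw [hM, mul_right_comm C]
    refine mul_le_mul_of_nonneg_right (mul_le_mul_of_nonneg_left (Real.exp_le_exp.2 ?_) hC0.le) hD0
    have := mul_le_mul_of_nonneg_left hk (by positivity : 0 ≤ (T + 1) * L)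
    linarith
  refine ⟨fun t ht => ?_, fun k hk => ?_⟩
  · set k := ⌊t / h⌋₊ with hk
    have hkt : k * h ≤ t := by
      rw [← le_div_iff₀ hh]
      exact Nat.floor_le (div_nonneg ht.1 hh.le)
    have htk : t - k * h ≤ h := by
      have := Nat.lt_floor_add_one (t / h)
      rw [div_lt_iff₀ hh, ← hk] at this
      linarith
    have h1 := (le_max_left _ _).trans (hboth k (hkt.trans ht.2))
    have h2 := H.norm_path_sub_le (by positivity : 0 ≤ (k : ℝ) * h) hkt ht.2
    have h3 : max 1 T * B * (t - k * h) ≤ max 1 T * B * D :=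
      mul_le_mul_of_nonneg_left (htk.trans (hhδ.trans hDδ)) (by positivity)
    have h4 := norm_sub_le (a.iterate F δ x₀ k - Y (k * h)) (Y t - Y (k * h))
    rw [sub_sub_sub_cancel_right] at h4
    have h5 : stepFun h (a.iterate F δ x₀) t = a.iterate F δ x₀ k := rfl
    rw [h5, add_mul]
    linarith
  · refine ((le_max_right _ _).trans (hboth k hk)).trans ?_
    exact mul_le_mul_of_nonneg_right (le_add_of_nonneg_right (by positivity)) hD0

end DescentMethod

end

/-! ### Localization to `Θ`, and the two deterministic estimates behind (i) and (ii) -/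

noncomputable section

namespace DescentMethod

theorem exists_tube {E : Type*} [PseudoMetricSpace E] {T : ℝ} (X : C(Icc (0 : ℝ) T, E)) {U : Set E}
    (hU : IsOpen U) (hX : ∀ t, X t ∈ U) : ∃ r : ℝ, 0 < r ∧ ∀ t, Metric.closedBall (X t) r ⊆ U := by
  obtain ⟨r, hr, h⟩ := (isCompact_range X.continuous).exists_cthickening_subset_open hU
    (range_subset_iff.2 hX)
  exact ⟨r, hr, fun t => (Metric.closedBall_subset_cthickening (mem_range_self t) r).trans h⟩

variable {E : Type*} [NormedAddCommGroup E] [NormedSpace ℝ E] [FiniteDimensional ℝ E]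

/-- The discretization error, for a field that is Lipschitz on a neighbourhood of the path. -/
theorem exists_discretization_bound_on (E : Type*) [NormedAddCommGroup E] [NormedSpace ℝ E]
    [FiniteDimensional ℝ E] {T : ℝ} (hT : 0 ≤ T) (L : ℝ≥0) {B : ℝ} (hB : 0 ≤ B) :
    ∃ M : ℝ, 0 < M ∧ ∀ (a : DescentMethod) (η r δ : ℝ) (F : E → E) (Θ : Set E)
      (G Y : C(Icc (0 : ℝ) T, E)) (x₀ y₀ : E),
      LipschitzOnWith L F Θ → (∀ t, Metric.closedBall (Y t) r ⊆ Θ) → (∀ t, ‖G t‖ ≤ B) →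
      (∀ t, ‖G t - F (Y t)‖ ≤ η) → (∀ t, Y t = y₀ - displacement a (IccExtend hT G) t) →
      0 < δ → δ ≤ 1 → M * (√δ + ‖x₀ - y₀‖ + η) ≤ r → ∀ t : Icc (0 : ℝ) T,
        ‖stepFun (a.timeStep δ) (a.iterate F δ x₀) t - Y t‖ ≤ M * (√δ + ‖x₀ - y₀‖ + η) := by
  have : CompleteSpace E := FiniteDimensional.complete ℝ E
  obtain ⟨M, hM, H⟩ := exists_discretization_bound E hT
    (L := (lipschitzExtensionConstant E * L : ℝ≥0)) (NNReal.coe_nonneg _) hB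
  refine ⟨M, hM, fun a η r δ F Θ G Y x₀ y₀ hF htube hG hη hY hδ hδ1 hr t => ?_⟩
  -- The iterates of the globally Lipschitz extension obey the bound unconditionally. The bound
  -- keeps their query points in the tube, hence in `Θ`, where the two fields agree; so these are
  -- also the iterates of `F`.
  obtain ⟨F', hF', hFF'⟩ := hF.extend_finite_dimension
  have hr0 : 0 ≤ r := by
    have := (norm_nonneg _).trans (hη t)
    exact le_trans (by positivity) hr
  have hYΘ : ∀ t, Y t ∈ Θ := fun t => htube t (Metric.mem_closedBall_self hr0)
  have happrox : IsApproxSolution a T (lipschitzExtensionConstant E * L : ℝ≥0) B η F'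
      (IccExtend hT G) (IccExtend hT Y) y₀ :=
    { lipschitz := fun x y => by simpa [dist_eq_norm] using hF'.dist_le_mul x y
      continuous := G.continuous.Icc_extend'
      norm_le := fun t ht => by rw [IccExtend_of_mem hT _ ht]; exact hG _
      residual := fun t ht => by
        rw [IccExtend_of_mem hT _ ht, IccExtend_of_mem hT _ ht, ← hFF' (hYΘ _)]
        exact hη _
      eq := fun t ht => by rw [IccExtend_of_mem hT _ ht, hY] }
  obtain ⟨h1, h2⟩ := H a η F' _ _ y₀ happrox x₀ δ hδ hδ1
  set h := a.timeStep δ with hh_def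
  have hh : 0 < h := a.timeStep_pos hδ
  have hkt : ⌊(t : ℝ) / h⌋₊ * h ≤ t := by
    rw [← le_div_iff₀ hh]
    exact Nat.floor_le (div_nonneg t.2.1 hh.le)
  have hq : ∀ k < ⌊(t : ℝ) / h⌋₊, a.query F' δ x₀ k ∈ Θ := fun k hk => by
    have hkT : k * h ≤ T :=
      (mul_le_mul_of_nonneg_right (by exact_mod_cast hk.le) hh.le).trans (hkt.trans t.2.2)
    have h3 := h2 k hkT
    have hmem : (k : ℝ) * h ∈ Icc 0 T := ⟨by positivity, hkT⟩
    rw [IccExtend_of_mem hT _ hmem] at h3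
    exact htube ⟨_, hmem⟩ (mem_closedBall_iff_norm.2 (h3.trans hr))
  have h4 := iterate_congr a hFF'.symm hq _ le_rfl
  have h5 := h1 t t.2
  rw [IccExtend_val] at h5
  rw [stepFun] at h5 ⊢
  rwa [← h4]

/-- The iterates of a perturbed field stay close to the solution for the perturbed field. -/
theorem exists_iterate_sub_solution_bound (a : DescentMethod) {T : ℝ} (hT : 0 < T) {Θ : Set E}
    (hΘ : IsOpen Θ) {F₀ : E → E} (hF₀ : ContinuousOn F₀ Θ) {x₀ : E} {X : C(Icc (0 : ℝ) T, E)}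
    (hX : a.Solves hT (fun _ => F₀) x₀ X) (hXΘ : ∀ t, X t ∈ Θ) (L : ℝ≥0) :
    ∃ M η₀ δ₀ : ℝ, 0 < M ∧ 0 < η₀ ∧ 0 < δ₀ ∧ ∀ (F : E → E) (ξ : E) (Y : C(Icc (0 : ℝ) T, E)),
      LipschitzOnWith L F Θ → (∀ t, ‖F (X t) - F₀ (X t)‖ ≤ η₀) → ‖ξ - x₀‖ ≤ η₀ →
      (∀ t, Y t ∈ Θ) → a.Solves hT (fun _ => F) ξ Y → ∀ δ : ℝ, 0 < δ → δ < δ₀ →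
      ∀ t : Icc (0 : ℝ) T, ‖stepFun (a.timeStep δ) (a.iterate F δ ξ) t - Y t‖
        ≤ M * (√δ * |Real.log δ|) := by
  have : CompleteSpace E := FiniteDimensional.complete ℝ E
  obtain ⟨r, hr, htube⟩ := exists_tube X hΘ hXΘ
  set G₀ : C(Icc (0 : ℝ) T, E) := ⟨fun t => F₀ (X t), hF₀.comp_continuous X.continuous hXΘ⟩ with hG₀
  have hXeq : ∀ t : Icc (0 : ℝ) T, X t = x₀ - displacement a (IccExtend hT.le G₀) t :=
    (solves_iff a hT G₀.continuous.Icc_extend' fun t => by rw [IccExtend_val]; rfl).1 hX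
  obtain ⟨M, hM, H⟩ := exists_discretization_bound_on E hT.le L
    (by positivity : 0 ≤ ‖G₀‖ + 2)
  set K := 2 * Real.exp ((2 * max 1 T * L + 1) * T) * (1 + max 1 T * T) with hK
  have hK0 : 0 < K := by positivity
  -- With `K` the Gronwall constant, these bounds keep `Y` within `r / 2` of `X` and give `‖G‖ ≤
  -- ‖G₀‖ + 2`: one unit for the perturbation of the field along `X`, one for the passage from `X`
  -- to `Y`.
  set η₀ := min 1 (min (r / 2 / K) (1 / (L * K + 1))) with hη₀
  have hη₀0 : 0 < η₀ := by positivity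
  refine ⟨M, η₀, min (Real.exp (-1)) ((r / (2 * M)) ^ 2), hM, hη₀0, by positivity,
    fun F ξ Y hF hFX hξ hYΘ hY δ hδ hδ₀ t => ?_⟩
  set G : C(Icc (0 : ℝ) T, E) :=
    ⟨fun t => F (Y t), hF.continuousOn.comp_continuous Y.continuous hYΘ⟩ with hG
  have hYeq : ∀ t : Icc (0 : ℝ) T, Y t = ξ - displacement a (IccExtend hT.le G) t :=
    (solves_iff a hT G.continuous.Icc_extend' fun t => by rw [IccExtend_val]; rfl).1 hY
  have hclose : ∀ t, ‖Y t - X t‖ ≤ K * η₀ := by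
    intro t
    set V : C(Icc (0 : ℝ) T, E) := Y - X with hV
    set W : C(Icc (0 : ℝ) T, E) := G - G₀ with hW
    have hVt : ∀ t, V t = Y t - X t := fun t => rfl
    have h := norm_le_of_eq_sub_displacement a (T := T) (L := L) (η := η₀) L.2 hη₀0.le
      (D := IccExtend hT.le V) (f := IccExtend hT.le W) (d := ξ - x₀)
      V.continuous.Icc_extend'.continuousOn
      (fun t ht => by
        have h1 : IccExtend hT.le W = IccExtend hT.le G + (-1 : ℝ) • IccExtend hT.le G₀ := by
          funext s
          simp [IccExtend, sub_eq_add_neg, hW]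
        rw [h1, displacement_add a G.continuous.Icc_extend'
          (by exact G₀.continuous.Icc_extend'.const_smul (-1 : ℝ)), displacement_const_smul,
          IccExtend_of_mem hT.le _ ht, hVt, hYeq, hXeq]
        simp only [neg_smul, one_smul]
        abel)
      (fun t ht => by
        rw [IccExtend_of_mem hT.le _ ht, IccExtend_of_mem hT.le _ ht, hVt]
        have h2 := hF.dist_le_mul _ (hYΘ ⟨t, ht⟩) _ (hXΘ ⟨t, ht⟩)
        rw [dist_eq_norm, dist_eq_norm] at h2
        have h3 : W ⟨t, ht⟩ = (F (Y ⟨t, ht⟩) - F (X ⟨t, ht⟩))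
          + (F (X ⟨t, ht⟩) - F₀ (X ⟨t, ht⟩)) := by
          rw [sub_add_sub_cancel]; rfl
        rw [h3]
        exact (norm_add_le _ _).trans (add_le_add h2 (hFX _))) t.2
    rw [IccExtend_val] at h
    refine h.trans ?_
    rw [hK, mul_assoc _ (1 + _)]
    refine mul_le_mul_of_nonneg_left ?_ (by positivity)
    linarith
  have hKη : K * η₀ ≤ r / 2 := by
    rw [mul_comm, ← le_div_iff₀ hK0]
    exact (min_le_right _ _).trans (min_le_left _ _)
  have hLKη : L * (K * η₀) ≤ 1 := by
    have h1 : η₀ ≤ 1 / (L * K + 1) := (min_le_right _ _).trans (min_le_right _ _)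
    rw [le_div_iff₀ (by positivity)] at h1
    linarith
  have hδe : δ < Real.exp (-1) := hδ₀.trans_le (min_le_left _ _)
  have hδ1 : δ ≤ 1 := hδe.le.trans (by rw [Real.exp_le_one_iff]; norm_num)
  have hsq : M * √δ ≤ r / 2 := by
    have h1 : √δ ≤ r / (2 * M) := by
      rw [Real.sqrt_le_left (by positivity)]
      exact (hδ₀.trans_le (min_le_right _ _)).le
    rw [le_div_iff₀ (by positivity)] at h1
    linarith
  have hlog : 1 ≤ |Real.log δ| := by
    have h1 : Real.log δ < -1 := by
      rwa [Real.log_lt_iff_lt_exp hδ]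
    rw [abs_of_neg (by linarith)]
    linarith
  -- The path solves the equation of `F` itself from the same initial value, so only `√δ` remains.
  -- The logarithm is at least `1` because `δ < exp (-1)`.
  have hfin := H a 0 (r / 2) δ F Θ G Y ξ ξ hF
    (fun t => (Metric.closedBall_subset_closedBall' (by
      rw [dist_eq_norm]
      linarith [hclose t])).trans (htube t))
    (fun t => by
      have h1 := hF.dist_le_mul _ (hYΘ t) _ (hXΘ t)
      rw [dist_eq_norm, dist_eq_norm] at h1
      have h2 : (L : ℝ) * ‖Y t - X t‖ ≤ L * (K * η₀) := mul_le_mul_of_nonneg_left (hclose t) L.2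
      have h3 : ‖F (X t) - F₀ (X t)‖ ≤ 1 := (hFX t).trans (min_le_left _ _)
      have h4 : ‖F₀ (X t)‖ ≤ ‖G₀‖ := G₀.norm_coe_le_norm t
      have h5 : G t = F₀ (X t) + (F (X t) - F₀ (X t)) + (F (Y t) - F (X t)) := by
        rw [add_sub_cancel, add_sub_cancel]; rfl
      rw [h5]
      have h6 := norm_add₃_le (a := F₀ (X t)) (b := F (X t) - F₀ (X t)) (c := F (Y t) - F (X t))
      linarith)
    (fun t => by rw [show G t = F (Y t) from rfl, sub_self, norm_zero]) hYeq hδ hδ1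
    (by simpa using hsq) t
  refine hfin.trans (mul_le_mul_of_nonneg_left ?_ hM.le)
  rw [sub_self, norm_zero, add_zero, add_zero]
  exact le_mul_of_one_le_right (Real.sqrt_nonneg δ) hlog

/-- The first-order expansion of the iterates of a perturbed field. The perturbation is
`c⁻¹ ζ`, the solution operator of the linearized equation is `Φ`. -/
theorem exists_iterate_expansion (a : DescentMethod) {T : ℝ} (hT : 0 < T) {Θ ΘX : Set E}
    (hsub : ΘX ⊆ Θ) {F₀ : E → E} (hF₀ : ContinuousOn F₀ Θ) {x₀ : E} {X : C(Icc (0 : ℝ) T, E)}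
    (hX : a.Solves hT (fun _ => F₀) x₀ X) (hXmem : ∀ t, X t ∈ interior ΘX)
    (A : C(Icc (0 : ℝ) T, E →L[ℝ] E))
    (hA : ∀ κ : ℝ, 0 < κ → ∃ ρ : ℝ, 0 < ρ ∧ ∀ t v, ‖v‖ ≤ ρ →
      ‖F₀ (X t + v) - F₀ (X t) - A t v‖ ≤ κ * ‖v‖)
    (Φ : C(Icc (0 : ℝ) T, E) →L[ℝ] C(Icc (0 : ℝ) T, E))
    (hΦ : ∀ z t, Φ z t = -displacement a (IccExtend hT.le (pathApply A (Φ z) + z)) t)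
    (L : ℝ≥0) {R ε : ℝ} (hR : 0 ≤ R) (hε : 0 < ε) :
    ∃ κ : ℝ, 0 < κ ∧ ∀ ρ : ℝ, 0 < ρ → ∃ c₀ : ℝ, ∀ (c δ : ℝ) (F : E → E) (ξ : E)
      (z : C(Icc (0 : ℝ) T, E)), c₀ ≤ c → 0 < δ → δ ≤ 1 → LipschitzOnWith L F Θ →
      (∀ t, z t = c • (F (X t) - F₀ (X t))) → ‖z‖ ≤ R →
      (∀ θ ∈ ΘX, ∀ ϑ ∈ ΘX, ‖θ - ϑ‖ ≤ ρ → ‖c • (F θ - F₀ θ) - c • (F ϑ - F₀ ϑ)‖ ≤ κ) →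
      c * ‖ξ - x₀‖ ≤ κ → c * √δ ≤ κ → ∀ t : Icc (0 : ℝ) T,
        ‖c • (stepFun (a.timeStep δ) (a.iterate F δ ξ) t - X t) - Φ z t‖ ≤ ε := by
  have : CompleteSpace E := FiniteDimensional.complete ℝ E
  obtain ⟨r, hr, htube⟩ := exists_tube X isOpen_interior hXmem
  have hXΘ : ∀ t, X t ∈ Θ := fun t => hsub (interior_subset (hXmem t))
  set G₀ : C(Icc (0 : ℝ) T, E) := ⟨fun t => F₀ (X t), hF₀.comp_continuous X.continuous hXΘ⟩ with hG₀
  have hXeq : ∀ t : Icc (0 : ℝ) T, X t = x₀ - displacement a (IccExtend hT.le G₀) t :=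
    (solves_iff a hT G₀.continuous.Icc_extend' fun t => by rw [IccExtend_val]; rfl).1 hX
  set N := ‖Φ‖ * R with hN
  have hN0 : 0 ≤ N := by positivity
  obtain ⟨M, hM, H⟩ := exists_discretization_bound_on E hT.le L
    (by positivity : 0 ≤ ‖G₀‖ + (‖A‖ * N + R))
  -- The budget after multiplication by `c`: `N κ` for the linearization of `F₀`, and `κ` each for
  -- the oscillation of the perturbation, for `√δ` and for the initial value. It does not involve
  -- `ρ`, which may thus be chosen afterwards.
  set κ := ε / (M * (N + 3)) with hκ
  have hκ0 : 0 < κ := by positivity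
  have hMκ : M * (κ * (N + 3)) = ε := by rw [hκ]; field_simp
  obtain ⟨ρ', hρ', hlin⟩ := hA κ hκ0
  refine ⟨κ, hκ0, fun ρ hρ => ?_⟩
  set q := min (r / 2) (min ρ ρ') with hq
  have hq0 : 0 < q := by positivity
  -- For such `c`, both `c⁻¹ N` and `c⁻¹ ε` are at most `q`: the corrected path stays in the tube
  -- and within reach of the linearization and of the modulus of continuity, and the final error
  -- fits into the remaining tube.
  refine ⟨max 1 ((N + ε) / q), fun c δ F ξ z hc hδ hδ1 hF hz hzR hosc hξ hcδ t => ?_⟩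
  have hc1 : 1 ≤ c := (le_max_left _ _).trans hc
  have hc0 : 0 < c := one_pos.trans_le hc1
  have hcinv : c⁻¹ ≤ 1 := inv_le_one_of_one_le₀ hc1
  have hcq : c⁻¹ * (N + ε) ≤ q := by
    have h1 := (le_max_right _ _).trans hc
    rw [div_le_iff₀ hq0] at h1
    rwa [inv_mul_le_iff₀ hc0]
  have hcN : c⁻¹ * N ≤ q := le_trans (mul_le_mul_of_nonneg_left (by linarith) (by positivity)) hcq
  have hcε : c⁻¹ * ε ≤ q := le_trans (mul_le_mul_of_nonneg_left (by linarith) (by positivity)) hcq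
  set v := Φ z with hv
  have hvN : ∀ t, ‖v t‖ ≤ N := fun t =>
    (v.norm_coe_le_norm t).trans (Φ.le_of_opNorm_le_of_le le_rfl hzR)
  have hcv : ∀ t, ‖c⁻¹ • v t‖ ≤ c⁻¹ * N := fun t => by
    rw [norm_smul, Real.norm_of_nonneg (by positivity)]
    exact mul_le_mul_of_nonneg_left (hvN t) (by positivity)
  -- The approximate solution. By the linear equation for `v` it is driven exactly by `G = G₀ + c⁻¹
  -- (A v + z)`, which agrees with `F` along `Y` to first order in `c⁻¹`.
  set Y : C(Icc (0 : ℝ) T, E) := X + c⁻¹ • v with hY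
  have hYX : ∀ t, Y t = X t + c⁻¹ • v t := fun t => rfl
  have hYmem : ∀ t, Y t ∈ Metric.closedBall (X t) (r / 2) := fun t => by
    rw [mem_closedBall_iff_norm, hYX, add_sub_cancel_left]
    exact (hcv t).trans (hcN.trans (min_le_left _ _))
  set w := pathApply A v + z with hw
  set G : C(Icc (0 : ℝ) T, E) := G₀ + c⁻¹ • w with hG
  have hYeq : ∀ t : Icc (0 : ℝ) T, Y t = x₀ - displacement a (IccExtend hT.le G) t := by
    intro t
    have h1 : IccExtend hT.le G = IccExtend hT.le G₀ + c⁻¹ • IccExtend hT.le w := by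
      funext s
      simp [IccExtend, hG]
    rw [h1, displacement_add a G₀.continuous.Icc_extend'
      (by exact w.continuous.Icc_extend'.const_smul c⁻¹), displacement_const_smul, hYX, hXeq,
      hv, hΦ z t, smul_neg]
    abel
  have hwle : ∀ t, ‖w t‖ ≤ ‖A‖ * N + R := fun t =>
    (norm_add_le _ _).trans (add_le_add
      ((A t).le_of_opNorm_le_of_le (A.norm_coe_le_norm t) (hvN t))
      ((z.norm_coe_le_norm t).trans hzR))
  have hGle : ∀ t, ‖G t‖ ≤ ‖G₀‖ + (‖A‖ * N + R) := fun t => by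
    refine (norm_add_le _ _).trans (add_le_add (G₀.norm_coe_le_norm t) ?_)
    rw [ContinuousMap.smul_apply, norm_smul, Real.norm_of_nonneg (by positivity)]
    exact (mul_le_of_le_one_left (norm_nonneg _) hcinv).trans (hwle t)
  have hres : ∀ t, ‖G t - F (Y t)‖ ≤ c⁻¹ * (κ * (N + 1)) := fun t => by
    have h1 : G t - F (Y t) = -(F₀ (X t + c⁻¹ • v t) - F₀ (X t) - A t (c⁻¹ • v t))
        + c⁻¹ • (c • (F (X t) - F₀ (X t)) - c • (F (Y t) - F₀ (Y t))) := by
      have h2 : G t = F₀ (X t) + c⁻¹ • (A t (v t) + c • (F (X t) - F₀ (X t))) := by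
        rw [← hz]; rfl
      rw [h2, ← hYX, map_smul, ← smul_sub c, smul_smul, inv_mul_cancel₀ hc0.ne', one_smul,
        smul_add, smul_smul c⁻¹ c, inv_mul_cancel₀ hc0.ne', one_smul]
      abel
    rw [h1]
    refine (norm_add_le _ _).trans ?_
    have h3 : ‖F₀ (X t + c⁻¹ • v t) - F₀ (X t) - A t (c⁻¹ • v t)‖ ≤ κ * (c⁻¹ * N) :=
      (hlin t _ ((hcv t).trans (hcN.trans ((min_le_right _ _).trans (min_le_right _ _))))).trans
        (mul_le_mul_of_nonneg_left (hcv t) hκ0.le)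
    have h4 : ‖c • (F (X t) - F₀ (X t)) - c • (F (Y t) - F₀ (Y t))‖ ≤ κ := by
      refine hosc _ (interior_subset (hXmem t)) _ ?_ ?_
      · exact interior_subset (htube t
          (Metric.closedBall_subset_closedBall (by linarith) (hYmem t)))
      · rw [norm_sub_rev, hYX, add_sub_cancel_left]
        exact (hcv t).trans (hcN.trans ((min_le_right _ _).trans (min_le_left _ _)))
    rw [norm_neg, norm_smul, Real.norm_of_nonneg (by positivity)]
    have h5 := mul_le_mul_of_nonneg_left h4 (by positivity : 0 ≤ c⁻¹)
    linarith
  have hbound : M * (√δ + ‖ξ - x₀‖ + c⁻¹ * (κ * (N + 1))) ≤ c⁻¹ * ε := by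
    have h1 : √δ ≤ c⁻¹ * κ := by rwa [le_inv_mul_iff₀ hc0]
    have h2 : ‖ξ - x₀‖ ≤ c⁻¹ * κ := by rwa [le_inv_mul_iff₀ hc0]
    have h3 : √δ + ‖ξ - x₀‖ + c⁻¹ * (κ * (N + 1)) ≤ c⁻¹ * (κ * (N + 3)) := by linarith
    refine (mul_le_mul_of_nonneg_left h3 hM.le).trans (le_of_eq ?_)
    rw [← hMκ]; ring
  have hfin := H a _ (r / 2) δ F Θ G Y ξ x₀ hF
    (fun t => (Metric.closedBall_subset_closedBall' (by
      have := Metric.mem_closedBall.1 (hYmem t)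
      linarith)).trans ((htube t).trans (interior_subset.trans hsub)))
    hGle hres hYeq hδ hδ1 (hbound.trans (hcε.trans (min_le_left _ _))) t
  have hsplit : c • (stepFun (a.timeStep δ) (a.iterate F δ ξ) t - X t) - v t
      = c • (stepFun (a.timeStep δ) (a.iterate F δ ξ) t - Y t) := by
    rw [hYX, ← sub_sub, smul_sub c _ (c⁻¹ • v t), smul_smul, mul_inv_cancel₀ hc0.ne', one_smul]
  rw [hsplit, norm_smul, Real.norm_of_nonneg hc0.le]
  have h1 := mul_le_mul_of_nonneg_left (hfin.trans hbound) hc0.le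
  rwa [← mul_assoc, mul_inv_cancel₀ hc0.ne', one_mul] at h1

end DescentMethod

end

noncomputable section

/-! ### Weak convergence -/

section WeakConvergence

variable {ι Ω' M : Type*} {Ω : ι → Type*} {m : ∀ i, MeasurableSpace (Ω i)}
  {μ : (i : ι) → Measure (Ω i)} [∀ i, IsProbabilityMeasure (μ i)]
  {m' : MeasurableSpace Ω'} {μ' : Measure Ω'} [IsProbabilityMeasure μ'] {l : Filter ι}
  [PseudoEMetricSpace M] [MeasurableSpace M] [BorelSpace M]
  {ζ : (i : ι) → Ω i → M} {Z : Ω' → M}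

namespace MeasureTheory.TendstoInDistribution

theorem limsup_measure_closed_le (h : TendstoInDistribution ζ l Z μ μ') {F : Set M}
    (hF : IsClosed F) : l.limsup (fun i => μ i {ω | ζ i ω ∈ F}) ≤ μ' {ω | Z ω ∈ F} := by
  have := ProbabilityMeasure.limsup_measure_closed_le_of_tendsto h.tendsto hF
  simp only [ProbabilityMeasure.coe_mk] at this
  rw [Measure.map_apply_of_aemeasurable h.aemeasurable_limit hF.measurableSet] at this
  refine le_trans (le_of_eq ?_) this
  congr 1
  funext i
  rw [Measure.map_apply_of_aemeasurable (h.forall_aemeasurable i) hF.measurableSet]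
  rfl

theorem ae_mem_of_isClosed [l.NeBot] (h : TendstoInDistribution ζ l Z μ μ') {S : Set M}
    (hS : IsClosed S) (hζ : ∀ i ω, ζ i ω ∈ S) : ∀ᵐ ω ∂μ', Z ω ∈ S := by
  have h1 := h.limsup_measure_closed_le hS
  simp only [hζ, ofPred_true, measure_univ, limsup_const] at h1
  exact (mem_ae_iff_prob_eq_one₀
    (h.aemeasurable_limit.nullMeasurable hS.measurableSet)).2 (le_antisymm prob_le_one h1)

/-- Substitute for tightness. The limit charges `S ∩ C k` less and less by continuity from above,
and the portmanteau inequality transfers this to the sequence. It yields stochastic boundedness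
along a path and asymptotic equicontinuity. -/
theorem exists_eventually_measure_le (h : TendstoInDistribution ζ l Z μ μ') {S : Set M}
    (hS : IsClosed S) (hζ : ∀ i ω, ζ i ω ∈ S) {C : ℕ → Set M} (hC : ∀ k, IsClosed (C k))
    (hCanti : Antitone C) (hSC : S ∩ ⋂ k, C k = ∅) {ε : ℝ≥0∞} (hε : 0 < ε) :
    ∃ k, ∀ᶠ i in l, μ i {ω | ζ i ω ∈ C k} ≤ ε := by
  have hlim : Tendsto (fun k => μ' {ω | Z ω ∈ S ∩ C k}) atTop (𝓝 0) := by
    have h1 := tendsto_measure_iInter_atTop (μ := μ'.map Z) (s := fun k => S ∩ C k)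
      (fun k => (hS.inter (hC k)).measurableSet.nullMeasurableSet)
      (fun i j hij => inter_subset_inter_right _ (hCanti hij))
      ⟨0, by
        have := Measure.isFiniteMeasure_map μ' Z
        exact measure_ne_top _ _⟩
    rw [← inter_iInter, hSC, measure_empty] at h1
    refine h1.congr fun k => ?_
    rw [Function.comp_apply,
      Measure.map_apply_of_aemeasurable h.aemeasurable_limit (hS.inter (hC k)).measurableSet]
    rfl
  obtain ⟨k, hk⟩ := (hlim.eventually_lt_const hε).exists
  refine ⟨k, ?_⟩
  have h2 := (h.limsup_measure_closed_le (hS.inter (hC k))).trans_lt hk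
  filter_upwards [eventually_lt_of_limsup_lt h2] with i hi
  refine le_trans (le_of_eq ?_) hi.le
  simp only [mem_inter_iff, hζ, true_and]

theorem comp_tendsto {κ : Type*} {l' : Filter κ} {n : κ → ι} (hn : Tendsto n l' l)
    (h : TendstoInDistribution ζ l Z μ μ') :
    TendstoInDistribution (fun j => ζ (n j)) l' Z (fun j => μ (n j)) μ' :=
  ⟨fun j => h.forall_aemeasurable (n j), h.aemeasurable_limit, h.tendsto.comp hn⟩

/-- A mapping theorem with a perturbation: `f` is continuous on a closed set that carries the
converging sequence, and the random variables `W i` are close to `f (ζ i)` in probability. -/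
theorem of_edist_map_tendsto_zero {D : Type*} [PseudoEMetricSpace D] [MeasurableSpace D]
    [BorelSpace D] [l.IsCountablyGenerated] (h : TendstoInDistribution ζ l Z μ μ') {S : Set M}
    (hS : IsClosed S) (hζ : ∀ i ω, ζ i ω ∈ S) {f : M → D} (hf : ContinuousOn f S)
    (hfm : Measurable f) {W : (i : ι) → Ω i → D} (hW : ∀ i, AEMeasurable (W i) (μ i))
    (hWf : ∀ ε : ℝ, 0 < ε →
      Tendsto (fun i => μ i {ω | ENNReal.ofReal ε < edist (W i ω) (f (ζ i ω))}) l (𝓝 0)) :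
    TendstoInDistribution W l (fun ω => f (Z ω)) μ μ' where
  forall_aemeasurable := hW
  aemeasurable_limit := hfm.comp_aemeasurable h.aemeasurable_limit
  tendsto := by
    have hfZ : AEMeasurable (fun ω => f (Z ω)) μ' := hfm.comp_aemeasurable h.aemeasurable_limit
    refine tendsto_of_forall_isClosed_limsup_le' fun F hF => ?_
    simp only [ProbabilityMeasure.coe_mk]
    have hfin := Measure.isFiniteMeasure_map μ' fun ω => f (Z ω)
    have hthick : ∀ ε : ℝ, 0 < ε → l.limsup (fun i => (μ i).map (W i) F)
        ≤ (μ'.map fun ω => f (Z ω)) (Metric.cthickening ε F) := by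
      intro ε hε
      -- As `f` is continuous only on `S`, it is the intersection with the closed set `S` that is
      -- closed; this loses nothing, since `ζ i` takes its values in `S`.
      have hcl : IsClosed (S ∩ f ⁻¹' Metric.cthickening ε F) :=
        hf.preimage_isClosed_of_isClosed hS Metric.isClosed_cthickening
      have hle : ∀ i, (μ i).map (W i) F
          ≤ μ i {ω | ζ i ω ∈ S ∩ f ⁻¹' Metric.cthickening ε F}
            + μ i {ω | ENNReal.ofReal ε < edist (W i ω) (f (ζ i ω))} := by
        intro i
        rw [Measure.map_apply_of_aemeasurable (hW i) hF.measurableSet]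
        refine (measure_mono fun ω hω => ?_).trans (measure_union_le _ _)
        rcases lt_or_ge (ENNReal.ofReal ε) (edist (W i ω) (f (ζ i ω))) with h1 | h1
        · exact Or.inr h1
        · refine Or.inl ⟨hζ i ω, ?_⟩
          rw [mem_preimage, Metric.mem_cthickening_iff]
          refine (Metric.infEDist_le_edist_of_mem (show W i ω ∈ F from hω)).trans ?_
          rwa [edist_comm]
      calc l.limsup (fun i => (μ i).map (W i) F)
          ≤ l.limsup (fun i => μ i {ω | ζ i ω ∈ S ∩ f ⁻¹' Metric.cthickening ε F}
            + μ i {ω | ENNReal.ofReal ε < edist (W i ω) (f (ζ i ω))}) :=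
            limsup_le_limsup (Eventually.of_forall hle)
        _ = l.limsup (fun i => μ i {ω | ζ i ω ∈ S ∩ f ⁻¹' Metric.cthickening ε F}) :=
            ENNReal.limsup_add_of_right_tendsto_zero (hWf ε hε) _
        _ ≤ μ' {ω | Z ω ∈ S ∩ f ⁻¹' Metric.cthickening ε F} := h.limsup_measure_closed_le hcl
        _ ≤ μ' ((fun ω => f (Z ω)) ⁻¹' Metric.cthickening ε F) := measure_mono fun ω hω => hω.2
        _ = _ := (Measure.map_apply_of_aemeasurable hfZ
            Metric.isClosed_cthickening.measurableSet).symm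
    have hlim := tendsto_measure_cthickening_of_isClosed (μ := μ'.map fun ω => f (Z ω))
      ⟨1, one_pos, measure_ne_top _ _⟩ hF
    refine ge_of_tendsto (hlim.mono_left (nhdsWithin_le_nhds (s := Ioi 0))) ?_
    filter_upwards [self_mem_nhdsWithin] with ε hε using hthick ε hε

end MeasureTheory.TendstoInDistribution

end WeakConvergence

end

noncomputable section

/-! ### Random fields along a path -/

namespace UniformFun

variable {α β γ : Type*}

theorem isClosed_setOf_uniformContinuous [UniformSpace α] [UniformSpace β] :
    IsClosed {f : UniformFun α β | UniformContinuous (toFun f)} := by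
  refine isClosed_of_closure_subset fun f hf => ?_
  rw [mem_closure_iff_frequently] at hf
  exact (UniformFun.tendsto_iff_tendstoUniformly.1 tendsto_id).uniformContinuous hf

/-- Precomposition with a map. -/
def precomp (φ : γ → α) (f : UniformFun α β) : UniformFun γ β := ofFun (toFun f ∘ φ)

theorem continuous_precomp [UniformSpace β] (φ : γ → α) :
    Continuous (precomp φ : UniformFun α β → UniformFun γ β) :=
  UniformFun.precomp_uniformContinuous.continuous

/-- The functions with an oscillation of at least `κ` on the scale `1 / (k + 1)`. -/
def oscillating (α β : Type*) [PseudoEMetricSpace α] [PseudoEMetricSpace β] (κ : ℝ≥0∞) (k : ℕ) :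
    Set (UniformFun α β) :=
  {f | κ ≤ edist
    (precomp (fun q : {q : α × α // edist q.1 q.2 ≤ ((k : ℝ≥0∞) + 1)⁻¹} => q.1.1) f)
    (precomp (fun q : {q : α × α // edist q.1 q.2 ≤ ((k : ℝ≥0∞) + 1)⁻¹} => q.1.2) f)}

section oscillating

variable [PseudoEMetricSpace α] [PseudoEMetricSpace β] {κ : ℝ≥0∞}

/-- The modulus of continuity at a fixed scale is the uniform distance of two precompositions of
`f`, hence continuous in `f`. -/
theorem isClosed_oscillating (k : ℕ) : IsClosed (oscillating α β κ k) :=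
  isClosed_le continuous_const ((continuous_precomp _).edist (continuous_precomp _))

theorem antitone_oscillating : Antitone (oscillating α β κ) := by
  intro i j hij f hf
  refine le_trans hf (edist_le.2 fun q => ?_)
  have hq : edist q.1.1 q.1.2 ≤ ((i : ℝ≥0∞) + 1)⁻¹ :=
    q.2.trans (ENNReal.inv_le_inv.2 (by gcongr))
  exact edist_eval_le (x := (⟨q.1, hq⟩ : {q : α × α // edist q.1 q.2 ≤ ((i : ℝ≥0∞) + 1)⁻¹}))
    (f := precomp (fun q : {q : α × α // edist q.1 q.2 ≤ ((i : ℝ≥0∞) + 1)⁻¹} => q.1.1) f)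
    (g := precomp (fun q : {q : α × α // edist q.1 q.2 ≤ ((i : ℝ≥0∞) + 1)⁻¹} => q.1.2) f)

theorem inter_iInter_oscillating (hκ : 0 < κ) (hκ' : κ ≠ ∞) :
    {f : UniformFun α β | UniformContinuous (toFun f)} ∩ ⋂ k, oscillating α β κ k = ∅ := by
  refine eq_empty_of_forall_notMem fun f hf => ?_
  obtain ⟨hf, hosc⟩ := hf
  obtain ⟨ρ, hρ, h⟩ := EMetric.uniformContinuous_iff.1 hf (κ / 2) (ENNReal.half_pos hκ.ne')
  obtain ⟨k, hk⟩ := ENNReal.exists_inv_nat_lt hρ.ne'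
  have h1 : κ ≤ κ / 2 := by
    refine le_trans (mem_iInter.1 hosc k) (edist_le.2 fun q => (h ?_).le)
    refine q.2.trans_lt (lt_of_le_of_lt ?_ hk)
    exact ENNReal.inv_le_inv.2 le_self_add
  exact absurd h1 (not_le.2 (ENNReal.half_lt_self hκ.ne' hκ'))

end oscillating

variable {E : Type*} [NormedAddCommGroup E]

/-- The functions that somewhere along the path `φ` have norm at least `k` (up to taking the
supremum). -/
def largeAlong (E : Type*) [NormedAddCommGroup E] (φ : γ → α) (k : ℕ) : Set (UniformFun α E) :=
  {f | (k : ℝ≥0∞) ≤ edist (precomp φ f) (ofFun 0)}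

theorem isClosed_largeAlong (φ : γ → α) (k : ℕ) : IsClosed (largeAlong E φ k) :=
  isClosed_le continuous_const ((continuous_precomp _).edist continuous_const)

theorem antitone_largeAlong (φ : γ → α) : Antitone (largeAlong E φ) := fun i _ hij _ hf =>
  show (i : ℝ≥0∞) ≤ _ from (Nat.cast_le.2 hij).trans hf

theorem inter_iInter_largeAlong [UniformSpace α] [TopologicalSpace γ] [CompactSpace γ] {φ : γ → α}
    (hφ : Continuous φ) :
    {f : UniformFun α E | UniformContinuous (toFun f)} ∩ ⋂ k, largeAlong E φ k = ∅ := by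
  refine eq_empty_of_forall_notMem fun f hf => ?_
  obtain ⟨hf, hlarge⟩ := hf
  have hc : Continuous (toFun f ∘ φ) := hf.continuous.comp hφ
  obtain ⟨C, hC0, hC⟩ := (isCompact_range hc).isBounded.exists_pos_norm_le
  obtain ⟨k, hk⟩ := exists_nat_gt C
  have h1 : (k : ℝ≥0∞) ≤ ENNReal.ofReal C := by
    refine le_trans (mem_iInter.1 hlarge k) (edist_le.2 fun x => ?_)
    rw [edist_dist]
    refine ENNReal.ofReal_le_ofReal ?_
    have := hC _ (mem_range_self x)
    rw [dist_eq_norm]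
    simpa [precomp] using this
  have h2 : ENNReal.ofReal C < ENNReal.ofReal k :=
    (ENNReal.ofReal_lt_ofReal_iff_of_nonneg hC0.le).2 hk
  rw [ENNReal.ofReal_natCast] at h2
  exact absurd h1 (not_le.2 h2)

open Classical in
/-- The values along the path `φ` of a uniformly continuous function. -/
def alongPath [UniformSpace α] [TopologicalSpace γ] (φ : C(γ, α)) (f : UniformFun α E) : C(γ, E) :=
  if h : UniformContinuous (toFun f) then ⟨toFun f ∘ φ, h.continuous.comp φ.continuous⟩ else 0

theorem alongPath_apply [UniformSpace α] [TopologicalSpace γ] (φ : C(γ, α)) {f : UniformFun α E}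
    (hf : UniformContinuous (toFun f)) (t : γ) : alongPath φ f t = toFun f (φ t) := by
  rw [alongPath, dif_pos hf]; rfl

theorem continuousOn_alongPath [UniformSpace α] [TopologicalSpace γ] [CompactSpace γ] (φ : C(γ, α)) :
    ContinuousOn (alongPath φ : UniformFun α E → C(γ, E))
      {f | UniformContinuous (toFun f)} := by
  refine LipschitzOnWith.continuousOn (K := 1) fun f hf g hg => ?_
  rw [ENNReal.coe_one, one_mul, ContinuousMap.edist_eq_iSup]
  refine iSup_le fun t => ?_
  rw [alongPath_apply φ hf, alongPath_apply φ hg]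
  exact edist_eval_le

/-- The map is continuous on the closed set of uniformly continuous functions and constant off it,
because `alongPath` is `0` there. -/
theorem measurable_comp_alongPath [UniformSpace α] [TopologicalSpace γ] [CompactSpace γ]
    (φ : C(γ, α)) {D : Type*} [TopologicalSpace D] [MeasurableSpace D] [BorelSpace D]
    {f : C(γ, E) → D} (hf : Continuous f) :
    Measurable fun g : UniformFun α E => f (alongPath φ g) := by
  refine measurable_of_restrict_of_restrict_compl
    (s := {g : UniformFun α E | UniformContinuous (toFun g)})
    isClosed_setOf_uniformContinuous.measurableSet ?_ ?_
  · exact (continuousOn_iff_continuous_domRestrict.1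
      (hf.comp_continuousOn (continuousOn_alongPath φ))).measurable
  · have : ({g : UniformFun α E | UniformContinuous (toFun g)}ᶜ.domRestrict
        fun g => f (alongPath φ g)) = fun _ => f 0 := by
      funext g
      have hg : ¬ UniformContinuous (toFun g.1) := g.2
      simp only [Set.domRestrict_apply, alongPath, dif_neg hg]
    rw [this]
    exact measurable_const

end UniformFun

/-! ### Random elements of the Skorokhod space -/

namespace SkorokhodSpace

variable {T : ℝ}

theorem edist_le_iSup {E : Type*} [PseudoEMetricSpace E] (f g : SkorokhodSpace T E) :
    edist f g ≤ ⨆ t, edist (f t) (g t) :=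
  iInf_le_of_le (OrderIso.refl _) (by simp [cost])

theorem continuous_toSkorokhod {E : Type*} [PseudoMetricSpace E] :
    Continuous (ContinuousMap.toSkorokhod : C(Icc (0 : ℝ) T, E) → SkorokhodSpace T E) := by
  refine LipschitzWith.continuous (K := 1) fun f g => ?_
  rw [ENNReal.coe_one, one_mul, ContinuousMap.edist_eq_iSup]
  exact edist_le_iSup _ _

variable {E : Type*} [NormedAddCommGroup E] [NormedSpace ℝ E]

theorem continuous_stepError (K : ℕ) (c h : ℝ) (X : C(Icc (0 : ℝ) T, E)) :
    Continuous fun y : Fin (K + 1) → E => stepError c h (fun k => y (Fin.ofNat (K + 1) k)) X := by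
  refine LipschitzWith.continuous (K := ‖c‖₊) fun y y' => (edist_le_iSup _ _).trans
    (iSup_le fun t => ?_)
  change edist (c • (stepFun h _ t - X t)) (c • (stepFun h _ t - X t)) ≤ _
  rw [edist_smul₀, edist_sub_right, ENNReal.smul_def, smul_eq_mul]
  gcongr
  exact edist_le_pi_edist y y' _

/-- Only the first `⌊T / h⌋₊ + 1` iterates are visible on `[0, T]`, so the random element is a
Lipschitz image of a finite-dimensional random vector. The reduction modulo `K + 1` is never
effective. -/
theorem measurable_stepError [SecondCountableTopology E] [MeasurableSpace E] [BorelSpace E]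
    {Ω : Type*} [MeasurableSpace Ω] {x : Ω → ℕ → E} (hx : ∀ k, Measurable fun ω => x ω k)
    (c h : ℝ) (X : C(Icc (0 : ℝ) T, E)) :
    Measurable fun ω => stepError c h (x ω) X := by
  set K := ⌊T / h⌋₊ with hK
  have heq : (fun ω => stepError c h (x ω) X) = (fun y : Fin (K + 1) → E =>
      stepError c h (fun k => y (Fin.ofNat (K + 1) k)) X) ∘ fun ω k => x ω k := by
    funext ω
    have hstep : ∀ t : Icc (0 : ℝ) T, stepFun h (x ω) t
        = stepFun h (fun k => x ω (Fin.ofNat (K + 1) k)) t := by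
      intro t
      have hle : ⌊(t : ℝ) / h⌋₊ ≤ K := by
        rcases le_or_gt h 0 with hh | hh
        · rw [Nat.floor_of_nonpos (div_nonpos_of_nonneg_of_nonpos t.2.1 hh)]
          exact Nat.zero_le _
        · exact Nat.floor_le_floor (div_le_div_of_nonneg_right t.2.2 hh.le)
      simp only [stepFun, Fin.ofNat, Nat.mod_eq_of_lt (Nat.lt_succ_of_le hle)]
    simp only [Function.comp_apply, stepError, hstep]
  rw [heq]
  exact (continuous_stepError K c h X).measurable.comp (measurable_pi_lambda _ fun k => hx k)

end SkorokhodSpace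

end

noncomputable section

/-! ### The empirical gradient -/

section Gradient

variable {E : Type*} [NormedAddCommGroup E] [InnerProductSpace ℝ E] [CompleteSpace E]

theorem ContDiffOn.gradient_of_isOpen {Θ : Set E} (hΘ : IsOpen Θ) {g : E → ℝ}
    (hg : ContDiffOn ℝ 2 g Θ) : ContDiffOn ℝ 1 (∇ g) Θ :=
  (InnerProductSpace.toDual ℝ E).symm.toContinuousLinearEquiv.contDiff.comp_contDiffOn
    (hg.fderiv_of_isOpen hΘ (by norm_num))

/-- The first-order expansion of the gradient is uniform along a path. -/
theorem exists_gradient_expansion {Θ : Set E} (hΘ : IsOpen Θ) {g : E → ℝ}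
    (hg : ContDiffOn ℝ 2 g Θ) {γ : Type*} [TopologicalSpace γ] [CompactSpace γ] (X : C(γ, E))
    (hX : ∀ t, X t ∈ Θ) {κ : ℝ} (hκ : 0 < κ) :
    ∃ ρ : ℝ, 0 < ρ ∧ ∀ t v, ‖v‖ ≤ ρ →
      ‖∇ g (X t + v) - ∇ g (X t) - hess g (X t) v‖ ≤ κ * ‖v‖ := by
  have h1 := ContDiffOn.gradient_of_isOpen hΘ hg
  have hcont : ContinuousOn (hess g) Θ := h1.continuousOn_fderiv_of_isOpen hΘ le_rfl
  have hK := isCompact_range X.continuous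
  have hKΘ : range X ⊆ Θ := range_subset_iff.2 hX
  -- Compactness of the path makes the modulus of continuity of the Hessian uniform in `t`; the mean
  -- value inequality on a ball then gives the expansion.
  have h2 := hK.uniformContinuousAt_of_continuousAt (hess g)
    (fun θ hθ => hcont.continuousAt (hΘ.mem_nhds (hKΘ hθ))) (Metric.dist_mem_uniformity hκ)
  obtain ⟨ρ, hρ, h3⟩ := Metric.mem_uniformity_dist.1 h2
  obtain ⟨r, hr, h4⟩ := hK.exists_cthickening_subset_open hΘ hKΘ
  refine ⟨min (ρ / 2) r, by positivity, fun t v hv => ?_⟩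
  have h5 := (convex_closedBall (X t) (min (ρ / 2) r)).norm_image_sub_le_of_norm_hasFDerivWithin_le'
    (f := ∇ g) (f' := hess g) (φ := hess g (X t)) (C := κ) (x := X t) (y := X t + v)
    (fun θ hθ => by
      have hθΘ : θ ∈ Θ := h4 (Metric.closedBall_subset_cthickening (mem_range_self t) r
        (Metric.closedBall_subset_closedBall (min_le_right _ _) hθ))
      exact ((h1.differentiableOn one_ne_zero).differentiableAt
        (hΘ.mem_nhds hθΘ)).hasFDerivAt.hasFDerivWithinAt)
    (fun θ hθ => by
      have hd : dist (X t) θ < ρ := by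
        rw [dist_comm]
        exact (Metric.mem_closedBall.1 hθ).trans_lt
          ((min_le_left _ _).trans_lt (half_lt_self hρ))
      have := h3 hd (mem_range_self t)
      rw [← dist_eq_norm, dist_comm]
      exact le_of_lt this)
    (Metric.mem_closedBall_self (by positivity)) (by simpa using hv)
  simpa using h5

theorem gradient_empRisk {S : Type*} {n : ℕ} {ℓ : E → S → ℝ} {Θ : Set E} (hΘ : IsOpen Θ)
    (hℓ : ∀ u, ContDiffOn ℝ 2 (fun θ => ℓ θ u) Θ) (u : Fin n → S) {θ : E} (hθ : θ ∈ Θ) :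
    ∇ (empRisk ℓ u) θ = (1 / (n : ℝ)) • ∑ i, ∇ (fun x => ℓ x (u i)) θ := by
  refine HasGradientAt.gradient ?_
  rw [hasGradientAt_iff_hasFDerivAt, map_smul, map_sum]
  refine HasFDerivAt.const_mul (HasFDerivAt.fun_sum fun i _ => ?_) _
  exact hasGradientAt_iff_hasFDerivAt.1 (((hℓ (u i)).differentiableOn two_ne_zero).differentiableAt
    (hΘ.mem_nhds hθ)).hasGradientAt

theorem empGrad_of_mem {S : Type*} {n : ℕ} {ℓ : E → S → ℝ} {Θ : Set E} (hΘ : IsOpen Θ)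
    (hℓ : ∀ u, ContDiffOn ℝ 2 (fun θ => ℓ θ u) Θ) (u : Fin n → S) {θ : E} (hθ : θ ∈ Θ) :
    empGrad ℓ Θ u θ = (1 / (n : ℝ)) • ∑ i, ∇ (fun x => ℓ x (u i)) θ := by
  rw [empGrad, indicator_of_mem hθ, gradient_empRisk hΘ hℓ u hθ]

/-- The average of the Lipschitz constants of the gradients of the loss. -/
def empLipschitz {S : Type*} {n : ℕ} (h₁ : S → ℝ) (u : Fin n → S) : ℝ≥0 :=
  (n : ℝ≥0)⁻¹ * ∑ i, ‖h₁ (u i)‖₊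

theorem lipschitzOnWith_empGrad {S : Type*} {n : ℕ} {ℓ : E → S → ℝ} {Θ : Set E} (hΘ : IsOpen Θ)
    (hℓ : ∀ u, ContDiffOn ℝ 2 (fun θ => ℓ θ u) Θ) {h₁ : S → ℝ}
    (hh₁ : ∀ u, ∀ θ ∈ Θ, ∀ ϑ ∈ Θ,
      ‖∇ (fun x => ℓ x u) θ - ∇ (fun x => ℓ x u) ϑ‖ ≤ h₁ u * ‖θ - ϑ‖) (u : Fin n → S) :
    LipschitzOnWith (empLipschitz h₁ u) (empGrad ℓ Θ u) Θ := by
  refine LipschitzOnWith.of_dist_le_mul fun θ hθ ϑ hϑ => ?_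
  rw [dist_eq_norm, dist_eq_norm, empGrad_of_mem hΘ hℓ u hθ, empGrad_of_mem hΘ hℓ u hϑ,
    ← smul_sub, ← Finset.sum_sub_distrib, norm_smul, Real.norm_of_nonneg (by positivity),
    empLipschitz]
  push_cast
  rw [one_div, mul_assoc, Finset.sum_mul]
  gcongr with i
  refine (norm_sum_le _ _).trans (Finset.sum_le_sum fun i _ => ?_)
  exact (hh₁ _ θ hθ ϑ hϑ).trans
    (mul_le_mul_of_nonneg_right (le_abs_self _) (norm_nonneg _))

theorem lintegral_empLipschitz_le {S Ω : Type*} [MeasurableSpace S] [MeasurableSpace Ω]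
    {P : Measure Ω} {Q : Measure S} {n : ℕ} {U : Fin n → Ω → S} (hU : ∀ i, Measurable (U i))
    (hlaw : ∀ i, P.map (U i) = Q) {h₁ : S → ℝ} (hh₁ : AEStronglyMeasurable h₁ Q) :
    ∫⁻ ω, (empLipschitz h₁ (fun i => U i ω) : ℝ≥0∞) ∂P ≤ ∫⁻ u, ‖h₁ u‖ₑ ∂Q := by
  have hm : ∀ i, AEMeasurable (fun ω => ‖h₁ (U i ω)‖ₑ) P := fun i =>
    AEMeasurable.comp_measurable (g := fun u => ‖h₁ u‖ₑ)
      (by rw [hlaw]; exact hh₁.enorm) (hU i)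
  have hi : ∀ i, ∫⁻ ω, ‖h₁ (U i ω)‖ₑ ∂P = ∫⁻ u, ‖h₁ u‖ₑ ∂Q := fun i => by
    rw [← hlaw i]
    exact (lintegral_map' (by rw [hlaw]; exact hh₁.enorm) (hU i).aemeasurable).symm
  have heq : ∀ ω, (empLipschitz h₁ (fun i => U i ω) : ℝ≥0∞)
      = ((n : ℝ≥0)⁻¹ : ℝ≥0) * ∑ i, ‖h₁ (U i ω)‖ₑ := fun ω => by
    rw [empLipschitz, ENNReal.coe_mul, ENNReal.ofNNReal_finsetSum]
    rfl
  simp only [heq]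
  rw [lintegral_const_mul'' _ (Finset.aemeasurable_fun_sum _ fun i _ => hm i),
    lintegral_finsetSum' _ fun i _ => hm i]
  simp only [hi, Finset.sum_const, Finset.card_univ, Fintype.card_fin, nsmul_eq_mul]
  rw [← mul_assoc]
  refine mul_le_of_le_one_left' ?_
  have : ((n : ℝ≥0)⁻¹ * (n : ℝ≥0)) ≤ 1 := inv_mul_le_one
  exact_mod_cast this

/-- Markov's inequality, uniform in `n` because the mean of the average is at most `E|h₁(U)|`. The
summand `1` in the choice of `L` keeps the denominator positive. -/
theorem exists_measure_empLipschitz_gt_le {S : Type*} [MeasurableSpace S] {Ω : ℕ → Type*}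
    [∀ n, MeasurableSpace (Ω n)] (P : ∀ n, Measure (Ω n)) {Q : Measure S}
    {U : ∀ n, Fin n → Ω n → S} (hU : ∀ n i, Measurable (U n i))
    (hlaw : ∀ n i, (P n).map (U n i) = Q) {h₁ : S → ℝ} (hh₁ : Integrable h₁ Q) {ε : ℝ≥0∞}
    (hε : 0 < ε) :
    ∃ L : ℝ≥0, ∀ n, P n {ω | L < empLipschitz h₁ (fun i => U n i ω)} ≤ ε := by
  set I := ∫⁻ u, ‖h₁ u‖ₑ ∂Q with hI
  have hI' : I ≠ ∞ := hh₁.2.ne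
  rcases eq_or_ne ε ∞ with rfl | hε'
  · exact ⟨0, fun n => le_top⟩
  set L := (I / ε + 1).toNNReal with hL
  have hfin : I / ε + 1 ≠ ∞ := ENNReal.add_ne_top.2 ⟨ENNReal.div_ne_top hI' hε.ne', ENNReal.one_ne_top⟩
  have hLc : (L : ℝ≥0∞) = I / ε + 1 := ENNReal.coe_toNNReal hfin
  refine ⟨L, fun n => ?_⟩
  have hm : AEMeasurable (fun ω => (empLipschitz h₁ (fun i => U n i ω) : ℝ≥0∞)) (P n) := by
    have hm' : ∀ i, AEMeasurable (fun ω => ‖h₁ (U n i ω)‖₊) (P n) := fun i =>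
      AEMeasurable.comp_measurable (g := fun u => ‖h₁ u‖₊)
        (by rw [hlaw]; exact hh₁.1.aemeasurable.nnnorm) (hU n i)
    exact ((Finset.aemeasurable_fun_sum _ fun i _ => hm' i).const_mul _).coe_nnreal_ennreal
  calc P n {ω | L < empLipschitz h₁ (fun i => U n i ω)}
      ≤ P n {ω | (L : ℝ≥0∞) ≤ empLipschitz h₁ (fun i => U n i ω)} :=
        measure_mono fun ω hω => ENNReal.coe_le_coe.2 (le_of_lt hω)
    _ ≤ (∫⁻ ω, (empLipschitz h₁ (fun i => U n i ω) : ℝ≥0∞) ∂P n) / L :=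
        meas_ge_le_lintegral_div hm (by rw [hLc]; positivity) ENNReal.coe_ne_top
    _ ≤ I / L := by gcongr; exact lintegral_empLipschitz_le (hU n) (hlaw n) hh₁.1
    _ ≤ ε := by
        refine ENNReal.div_le_of_le_mul ?_
        rw [hLc, mul_add, mul_one, ENNReal.mul_div_cancel hε.ne' hε']
        exact le_self_add

end Gradient

section Measurability

variable {p : ℕ} {S : Type*} [MeasurableSpace S]

/-- Each directional derivative is a limit of difference quotients, measurable once the shifted
points lie in `Θ`; hence the index shift by `N`. -/
theorem measurable_gradient {ℓ : EuclideanSpace ℝ (Fin p) → S → ℝ}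
    {Θ : Set (EuclideanSpace ℝ (Fin p))} (hΘ : IsOpen Θ) (hm : ∀ θ ∈ Θ, Measurable (ℓ θ))
    (hℓ : ∀ u, ContDiffOn ℝ 2 (fun θ => ℓ θ u) Θ) {θ : EuclideanSpace ℝ (Fin p)} (hθ : θ ∈ Θ) :
    Measurable fun u => ∇ (fun x => ℓ x u) θ := by
  have hinner : ∀ v : EuclideanSpace ℝ (Fin p),
      Measurable fun u => inner ℝ v (∇ (fun x => ℓ x u) θ) := by
    intro v
    have hlim : Tendsto (fun n : ℕ => θ + (n : ℝ)⁻¹ • v) atTop (𝓝 θ) := by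
      have h1 : Tendsto (fun n : ℕ => (n : ℝ)⁻¹ • v) atTop (𝓝 ((0 : ℝ) • v)) :=
        tendsto_natCast_atTop_atTop.inv_tendsto_atTop.smul_const v
      rw [zero_smul] at h1
      simpa using h1.const_add θ
    obtain ⟨N, hN⟩ := eventually_atTop.1 (hlim.eventually (hΘ.mem_nhds hθ))
    refine measurable_of_tendsto_metrizable (f := fun (n : ℕ) u => ((n + N : ℕ) : ℝ) *
      (ℓ (θ + ((n + N : ℕ) : ℝ)⁻¹ • v) u - ℓ θ u)) (fun n => ?_) ?_
    · exact ((hm _ (hN _ (Nat.le_add_left N n))).sub (hm θ hθ)).const_mul _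
    · rw [tendsto_pi_nhds]
      intro u
      have hd := (((hℓ u).differentiableOn two_ne_zero).differentiableAt
        (hΘ.mem_nhds hθ)).hasFDerivAt
      have h1 := hd.lim v (c := fun n : ℕ => (n : ℝ)) (l := atTop)
        (tendsto_norm_atTop_atTop.comp tendsto_natCast_atTop_atTop)
      have h2 : inner ℝ v (∇ (fun x => ℓ x u) θ) = fderiv ℝ (fun x => ℓ x u) θ v := by
        rw [real_inner_comm]
        exact InnerProductSpace.toDual_symm_apply
      rw [h2]
      exact h1.comp (tendsto_add_atTop_nat N)
  have hsum : (fun u => ∇ (fun x => ℓ x u) θ) = fun u =>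
      ∑ i, inner ℝ (EuclideanSpace.basisFun (Fin p) ℝ i) (∇ (fun x => ℓ x u) θ)
        • EuclideanSpace.basisFun (Fin p) ℝ i := by
    funext u
    exact ((EuclideanSpace.basisFun (Fin p) ℝ).sum_repr' _).symm
  rw [hsum]
  exact Finset.measurable_fun_sum _ fun i _ => (hinner _).smul_const _

-- On `Θ` this is a Carathéodory function, continuous in the parameter and measurable in `ω`, hence
-- jointly measurable; off `Θ` it is zero.
open Classical in
theorem measurable_empGrad_comp {Ω : Type*} [MeasurableSpace Ω] {n : ℕ} {U : Fin n → Ω → S}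
    (hU : ∀ i, Measurable (U i)) {ℓ : EuclideanSpace ℝ (Fin p) → S → ℝ}
    {Θ : Set (EuclideanSpace ℝ (Fin p))} (hΘ : IsOpen Θ) (hm : ∀ θ ∈ Θ, Measurable (ℓ θ))
    (hℓ : ∀ u, ContDiffOn ℝ 2 (fun θ => ℓ θ u) Θ) {x : Ω → EuclideanSpace ℝ (Fin p)}
    (hx : Measurable x) : Measurable fun ω => empGrad ℓ Θ (fun i => U i ω) (x ω) := by
  set u : Θ → Ω → EuclideanSpace ℝ (Fin p) := fun θ ω =>
    (1 / (n : ℝ)) • ∑ i, ∇ (fun x => ℓ x (U i ω)) θ with hu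
  have hjoint : Measurable (Function.uncurry u) := by
    refine measurable_uncurry_of_continuous_of_measurable (fun ω => ?_) fun θ => ?_
    · have hc : ∀ i, Continuous fun θ : Θ => ∇ (fun x => ℓ x (U i ω)) θ := fun i => continuousOn_iff_continuous_domRestrict.1
        (ContDiffOn.gradient_of_isOpen hΘ (hℓ (U i ω))).continuousOn
      exact (continuous_finsetSum Finset.univ fun i _ => hc i).const_smul (1 / (n : ℝ))
    · have hc : ∀ i, Measurable fun ω => ∇ (fun x => ℓ x (U i ω)) (θ : EuclideanSpace ℝ (Fin p)) :=
        fun i => (measurable_gradient hΘ hm hℓ θ.2).comp (hU i)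
      exact (Finset.measurable_fun_sum Finset.univ fun i _ => hc i).const_smul (1 / (n : ℝ))
  have heq : (fun ω => empGrad ℓ Θ (fun i => U i ω) (x ω)) = fun ω =>
      if hω : ω ∈ x ⁻¹' Θ then Function.uncurry u (⟨x ω, hω⟩, ω) else 0 := by
    funext ω
    by_cases hω : ω ∈ x ⁻¹' Θ
    · rw [dif_pos hω]
      exact empGrad_of_mem hΘ hℓ _ hω
    · rw [dif_neg hω, empGrad, indicator_of_notMem (show x ω ∉ Θ from hω)]
  rw [heq]
  refine Measurable.dite (s := x ⁻¹' Θ)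
    (f := fun ω => Function.uncurry u (⟨x ω, ω.2⟩, (ω : Ω))) ?_ (g := fun _ => 0)
    measurable_const (hx hΘ.measurableSet)
  exact hjoint.comp (((hx.comp measurable_subtype_coe).subtype_mk).prodMk measurable_subtype_coe)

theorem DescentMethod.measurable_iterate {E Ω : Type*} [NormedAddCommGroup E] [NormedSpace ℝ E]
    [MeasurableSpace E] [BorelSpace E] [SecondCountableTopology E] [MeasurableSpace Ω]
    (a : DescentMethod) {F : Ω → E → E}
    (hF : ∀ x : Ω → E, Measurable x → Measurable fun ω => F ω (x ω)) (δ : ℝ) {x₀ : Ω → E}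
    (hx₀ : Measurable x₀) (k : ℕ) : Measurable fun ω => a.iterate (F ω) δ (x₀ ω) k := by
  cases a
  · induction k with
    | zero => exact hx₀
    | succ k ih => exact ih.sub ((hF _ ih).const_smul δ)
  · have h : (Measurable fun ω => (acceleratedIterate (F ω) δ (x₀ ω) k).1) ∧
        Measurable fun ω => (acceleratedIterate (F ω) δ (x₀ ω) k).2 := by
      induction k with
      | zero => exact ⟨hx₀, hx₀⟩
      | succ k ih =>
        have h1 := ih.2.sub ((hF _ ih.2).const_smul δ)
        exact ⟨h1, h1.add ((h1.sub ih.1).const_smul _)⟩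
    exact h.1

end Measurability

end

/-! ### Pointwise bounds off the exceptional sets, uniqueness for the linear equation, and the rate
-/

noncomputable section

namespace UniformFun

variable {α γ E : Type*} [NormedAddCommGroup E]

theorem norm_le_of_notMem_largeAlong {φ : γ → α} {k : ℕ} {f : UniformFun α E}
    (hf : f ∉ largeAlong E φ k) (t : γ) : ‖toFun f (φ t)‖ ≤ k := by
  have h1 : edist (toFun f (φ t)) 0 ≤ k :=
    (edist_eval_le (f := precomp φ f) (g := ofFun 0) (x := t)).trans (not_le.1 hf).le
  rw [edist_dist, dist_zero_right] at h1
  exact (ENNReal.ofReal_le_natCast.1 h1)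

theorem norm_sub_le_of_notMem_oscillating [PseudoMetricSpace α] {κ : ℝ} (hκ : 0 ≤ κ) {k : ℕ}
    {f : UniformFun α E} (hf : f ∉ oscillating α E (ENNReal.ofReal κ) k) {x y : α}
    (hxy : dist x y ≤ ((k : ℝ) + 1)⁻¹) : ‖toFun f x - toFun f y‖ ≤ κ := by
  have hq : edist x y ≤ ((k : ℝ≥0∞) + 1)⁻¹ := by
    rw [edist_dist]
    refine (ENNReal.ofReal_le_ofReal hxy).trans (le_of_eq ?_)
    rw [ENNReal.ofReal_inv_of_pos (by positivity), ENNReal.ofReal_add (by positivity) zero_le_one,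
      ENNReal.ofReal_natCast, ENNReal.ofReal_one]
  have h1 : edist (toFun f x) (toFun f y) ≤ ENNReal.ofReal κ :=
    (edist_eval_le
      (x := (⟨(x, y), hq⟩ : {q : α × α // edist q.1 q.2 ≤ ((k : ℝ≥0∞) + 1)⁻¹}))
      (f := precomp (fun q : {q : α × α // edist q.1 q.2 ≤ ((k : ℝ≥0∞) + 1)⁻¹} => q.1.1) f)
      (g := precomp (fun q : {q : α × α // edist q.1 q.2 ≤ ((k : ℝ≥0∞) + 1)⁻¹} => q.1.2) f)).trans
      (not_le.1 hf).le
  rw [edist_dist, dist_eq_norm] at h1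
  exact (ENNReal.ofReal_le_ofReal_iff hκ).1 h1

end UniformFun

theorem measure_le_of_subset_union {Ω : Type*} [MeasurableSpace Ω] {μ : Measure Ω}
    {s A B C D : Set Ω} {ε : ℝ} (hε : 0 ≤ ε) (h : s ⊆ A ∪ B ∪ (C ∪ D))
    (hA : μ A ≤ ENNReal.ofReal (ε / 4)) (hB : μ B ≤ ENNReal.ofReal (ε / 4))
    (hC : μ C ≤ ENNReal.ofReal (ε / 4)) (hD : μ D ≤ ENNReal.ofReal (ε / 4)) :
    μ s ≤ ENNReal.ofReal ε := by
  have h4 : 0 ≤ ε / 4 := by positivity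
  calc μ s ≤ μ (A ∪ B) + μ (C ∪ D) := (measure_mono h).trans (measure_union_le _ _)
    _ ≤ (μ A + μ B) + (μ C + μ D) := add_le_add (measure_union_le _ _) (measure_union_le _ _)
    _ ≤ (ENNReal.ofReal (ε / 4) + ENNReal.ofReal (ε / 4))
        + (ENNReal.ofReal (ε / 4) + ENNReal.ofReal (ε / 4)) :=
        add_le_add (add_le_add hA hB) (add_le_add hC hD)
    _ = ENNReal.ofReal ε := by
        rw [← ENNReal.ofReal_add h4 h4, ← ENNReal.ofReal_add (by positivity) (by positivity)]
        congr 1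
        ring

theorem DescentMethod.eq_solution_operator_apply {E : Type*} [NormedAddCommGroup E]
    [NormedSpace ℝ E] [CompleteSpace E] (a : DescentMethod) {T : ℝ} (hT : 0 ≤ T)
    (A : C(Icc (0 : ℝ) T, E →L[ℝ] E)) {z v w : C(Icc (0 : ℝ) T, E)}
    (hv : ∀ t, v t = -displacement a (IccExtend hT (pathApply A v + z)) t)
    (hw : ∀ t, w t = -displacement a (IccExtend hT (pathApply A w + z)) t) : v = w := by
  ext1 t
  set D : C(Icc (0 : ℝ) T, E) := v - w with hD
  have hDt : ∀ t, D t = v t - w t := fun t => rfl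
  set fv := pathApply A v + z with hfv
  set fw := pathApply A w + z with hfw
  have h := norm_le_of_eq_sub_displacement a (T := T) (L := ‖A‖) (η := 0) (norm_nonneg A) le_rfl
    (D := IccExtend hT D) (f := IccExtend hT (pathApply A D)) (d := 0)
    D.continuous.Icc_extend'.continuousOn
    (fun t ht => by
      have h1 : IccExtend hT (pathApply A D) = IccExtend hT fv + (-1 : ℝ) • IccExtend hT fw := by
        rw [hD, map_sub]
        funext s
        simp [IccExtend, hfv, hfw, sub_eq_add_neg]
      rw [h1, displacement_add a fv.continuous.Icc_extend'
        (by exact fw.continuous.Icc_extend'.const_smul (-1 : ℝ)), displacement_const_smul,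
        IccExtend_of_mem hT _ ht, hDt, hv, hw]
      simp only [neg_smul, one_smul]
      abel)
    (fun t ht => by
      rw [IccExtend_of_mem hT _ ht, IccExtend_of_mem hT _ ht, add_zero]
      exact (A ⟨t, ht⟩).le_of_opNorm_le (A.norm_coe_le_norm _) _) t.2
  rw [IccExtend_val] at h
  simp only [norm_zero, mul_zero, zero_mul, add_zero] at h
  exact sub_eq_zero.1 (norm_le_zero_iff.1 h)

/-- For `δ < exp (-1)` the squared logarithm is at least `1` and can be dropped. -/
theorem tendsto_sqrt_mul_sqrt_zero {δ : ℕ → ℝ} {n : ℕ → ℕ} (hδ : Tendsto δ atTop (𝓝[>] 0))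
    (h : Tendsto (fun j => n j * δ j * |Real.log (δ j)| ^ 2) atTop (𝓝 0)) :
    Tendsto (fun j => √(n j : ℝ) * √(δ j)) atTop (𝓝 0) := by
  have h1 : Tendsto (fun j => (n j : ℝ) * δ j) atTop (𝓝 0) := by
    refine squeeze_zero' ?_ ?_ h
    · filter_upwards [hδ.eventually self_mem_nhdsWithin] with j hj
      exact mul_nonneg (Nat.cast_nonneg _) (le_of_lt hj)
    · filter_upwards [hδ.eventually (Ioo_mem_nhdsGT (Real.exp_pos (-1)))] with j hj
      have hlog : Real.log (δ j) < -1 := (Real.log_lt_iff_lt_exp hj.1).2 hj.2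
      have h2 : 1 ≤ |Real.log (δ j)| ^ 2 := by
        refine one_le_pow₀ ?_
        rw [abs_of_neg (by linarith)]
        linarith
      exact le_mul_of_one_le_right (mul_nonneg (Nat.cast_nonneg _) hj.1.le) h2
  have h2 := (Real.continuous_sqrt.tendsto 0).comp h1
  rw [Real.sqrt_zero] at h2
  exact h2.congr fun j => Real.sqrt_mul (Nat.cast_nonneg _) _

end

/-! ### Proof of the theorem -/

theorem theorem3p2 {p : ℕ} {S : Type*} [MeasurableSpace S]
    -- the loss, the law of one observation, the parameter set, the risk, the initial value
    (Θ : Set (EuclideanSpace ℝ (Fin p))) (hΘ : IsOpen Θ)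
    (ℓ : EuclideanSpace ℝ (Fin p) → S → ℝ) (Q : Measure S) [IsProbabilityMeasure Q]
    (g : EuclideanSpace ℝ (Fin p) → ℝ) (x₀ : EuclideanSpace ℝ (Fin p))
    -- for each `n`, an i.i.d. sample of size `n` from `Q` and a random initial value
    {Ω : ℕ → Type*} [∀ n, MeasurableSpace (Ω n)] (P : ∀ n, Measure (Ω n))
    [∀ n, IsProbabilityMeasure (P n)]
    (U : ∀ n, Fin n → Ω n → S) (hUmeas : ∀ n i, Measurable (U n i))
    (hUlaw : ∀ n i, (P n).map (U n i) = Q) (hUindep : ∀ n, iIndepFun (U n) (P n))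
    (x₀n : ∀ n, Ω n → EuclideanSpace ℝ (Fin p)) (hx₀meas : ∀ n, Measurable (x₀n n))
    (hx₀ : IsLittleOP P atTop (fun n ω => ‖x₀n n ω - x₀‖ₑ) (fun n => 1 / √(n : ℝ)))
    -- the loss, the risk and the covariances are regular
    (hloss : RegularLoss Θ ℓ Q) (hrisk : RegularRisk Θ ℓ Q g) (hcov : RegularCov Θ ℓ Q)
    -- the rescaled empirical gradient converges weakly to `Z`, uniformly over `ΘX`
    (ΘX : Set (EuclideanSpace ℝ (Fin p))) (hΘXsub : ΘX ⊆ Θ) (hΘXbdd : Bornology.IsBounded ΘX)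
    {Ω' : Type*} [MeasurableSpace Ω'] (P' : Measure Ω') [IsProbabilityMeasure P']
    (Z : Ω' → EuclideanSpace ℝ (Fin p) → EuclideanSpace ℝ (Fin p))
    (hZ : IsGaussianField P' ΘX ℓ Q Z)
    (hclt : TendstoInDistribution
      (fun (n : ℕ) ω => restrictUniform ΘX fun θ =>
        √(n : ℝ) • (empGrad ℓ Θ (fun i => U n i ω) θ - ∇ g θ))
      atTop (fun ω => restrictUniform ΘX (Z ω)) P P')
    -- the method, the time horizon, and the limiting curve `X` in the interior of `ΘX`
    (a : DescentMethod) (T : ℝ) (hT : 0 < T)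
    (X : C(Icc (0 : ℝ) T, EuclideanSpace ℝ (Fin p))) (hX : a.Solves hT (fun _ => ∇ g) x₀ X)
    (hXmem : ∀ t, X t ∈ interior ΘX) :
    -- the order of the discretization error, as `δ → 0` and `n → ∞`
    (∀ Xn : ∀ n, Ω n → C(Icc (0 : ℝ) T, EuclideanSpace ℝ (Fin p)),
      Tendsto (fun n => P n {ω | ¬ ((∀ t, Xn n ω t ∈ Θ) ∧
        a.Solves hT (fun _ => empGrad ℓ Θ fun i => U n i ω) (x₀n n ω) (Xn n ω))}) atTop (𝓝 0) →
      IsBigOP (fun q : ℝ × ℕ => P q.2) (𝓝[>] 0 ×ˢ atTop)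
        (fun q ω => ⨆ t : Icc (0 : ℝ) T,
          ‖stepFun (a.timeStep q.1)
              (a.iterate (empGrad ℓ Θ fun i => U q.2 i ω) q.1 (x₀n q.2 ω)) t - Xn q.2 ω t‖ₑ)
        (fun q => √q.1 * |Real.log q.1|)) ∧
    -- the limit process `V` exists, is unique, and is the weak limit in `D([0, T])`
    ∃ V : Ω' → C(Icc (0 : ℝ) T, EuclideanSpace ℝ (Fin p)),
      (∀ᵐ ω ∂P', a.Solves hT (fun t v => hess g (X t) v + Z ω (X t)) 0 (V ω)) ∧
      (∀ V' : Ω' → C(Icc (0 : ℝ) T, EuclideanSpace ℝ (Fin p)),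
        (∀ᵐ ω ∂P', a.Solves hT (fun t v => hess g (X t) v + Z ω (X t)) 0 (V' ω)) → V' =ᵐ[P'] V) ∧
      ∀ (δ : ℕ → ℝ) (n : ℕ → ℕ), Tendsto δ atTop (𝓝[>] 0) → Tendsto n atTop atTop →
        Tendsto (fun j => n j * δ j * |Real.log (δ j)| ^ 2) atTop (𝓝 0) →
        TendstoInDistribution
          (fun j ω => stepError √(n j : ℝ) (a.timeStep (δ j))
            (a.iterate (empGrad ℓ Θ fun i => U (n j) i ω) (δ j) (x₀n (n j) ω)) X)
          atTop (fun ω => (V ω).toSkorokhod) (fun j => P (n j)) P' := by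
  classical
  obtain ⟨h₁, hh₁mem, hh₁⟩ := hloss.lipschitz
  have hh₁int : Integrable h₁ Q := hh₁mem.integrable (by norm_num)
  obtain ⟨Lg, hLg⟩ := hrisk.lipschitz
  set F : ∀ n, Ω n → EuclideanSpace ℝ (Fin p) → EuclideanSpace ℝ (Fin p) :=
    fun n ω => empGrad ℓ Θ fun i => U n i ω with hF
  have hFlip : ∀ n ω, LipschitzOnWith (empLipschitz h₁ fun i => U n i ω) (F n ω) Θ :=
    fun n ω => lipschitzOnWith_empGrad hΘ hloss.contDiffOn hh₁ _
  have hgrad : ContinuousOn (∇ g) Θ := hLg.continuousOn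
  have hXΘ : ∀ t, X t ∈ Θ := fun t => hΘXsub (interior_subset (hXmem t))
  set φ : C(Icc (0 : ℝ) T, ΘX) := ⟨fun t => ⟨X t, interior_subset (hXmem t)⟩,
    X.continuous.subtype_mk _⟩ with hφ
  set ζ : ∀ n, Ω n → UniformFun ΘX (EuclideanSpace ℝ (Fin p)) := fun n ω =>
    restrictUniform ΘX fun θ => √(n : ℝ) • (F n ω θ - ∇ g θ) with hζdef
  -- Both gradients are Lipschitz on `Θ`, so the rescaled process is uniformly continuous for every
  -- `ω`. The set of such functions is closed, so the limit inherits the property almost surely.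
  have hζ : ∀ n ω, ζ n ω ∈ {f : UniformFun ΘX (EuclideanSpace ℝ (Fin p)) |
      UniformContinuous (UniformFun.toFun f)} := fun n ω => by
    have h1 := ((((hFlip n ω).sub hLg).mono hΘXsub).uniformContinuousOn)
    exact (uniformContinuousOn_iff_restrict.1 h1).const_smul √(n : ℝ)
  have hS := UniformFun.isClosed_setOf_uniformContinuous (α := ΘX)
    (β := EuclideanSpace ℝ (Fin p))
  have hsqrt : Tendsto (fun n : ℕ => √(n : ℝ)) atTop atTop :=
    Real.tendsto_sqrt_atTop.comp tendsto_natCast_atTop_atTop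
  refine ⟨fun Xn hXn ε hε => ?_, ?_⟩
  · have hε4 : 0 < ENNReal.ofReal (ε / 4) := ENNReal.ofReal_pos.2 (by positivity)
    obtain ⟨L, hL⟩ := exists_measure_empLipschitz_gt_le P hUmeas hUlaw hh₁int hε4
    obtain ⟨M, η₀, δ₀, hM, hη₀, hδ₀, H⟩ :=
      a.exists_iterate_sub_solution_bound hT hΘ hgrad hX hXΘ L
    obtain ⟨k, hk⟩ := hclt.exists_eventually_measure_le hS hζ
      (UniformFun.isClosed_largeAlong φ) (UniformFun.antitone_largeAlong φ)
      (UniformFun.inter_iInter_largeAlong φ.continuous) hε4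
    refine ⟨M, hM, ?_⟩
    filter_upwards [(show ∀ᶠ δ in 𝓝[>] (0 : ℝ), δ ∈ Ioo 0 δ₀ from Ioo_mem_nhdsGT hδ₀).prod_mk
      (hk.and (((hsqrt.atTop_mul_const hη₀).eventually_ge_atTop (k : ℝ)).and
        ((ENNReal.tendsto_nhds_zero.1 (hx₀ η₀ hη₀) _ hε4).and
          ((ENNReal.tendsto_nhds_zero.1 hXn _ hε4).and (eventually_ge_atTop 1)))))]
      with q ⟨hδ, hk, hkn, hx, hsol, hn⟩
    have hn1 : 1 ≤ √(q.2 : ℝ) := Real.one_le_sqrt.2 (by exact_mod_cast hn)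
    -- Four exceptional events, each of probability at most `ε / 4`: a large Lipschitz constant, a
    -- large process along `X`, a distant initial value, and a path that is not a solution in `Θ`.
    refine measure_le_of_subset_union hε.le ?_ (hL q.2) hk hx hsol
    intro ω hω
    by_contra hnot
    simp only [mem_union, not_or] at hnot
    obtain ⟨⟨hn1', hn2⟩, hn3, hn4⟩ := hnot
    have hL' : empLipschitz h₁ (fun i => U q.2 i ω) ≤ L := not_lt.1 hn1'
    have hgood := not_not.1 hn4
    have hx' : ‖x₀n q.2 ω - x₀‖ ≤ η₀ := by
      have h1 : ‖x₀n q.2 ω - x₀‖ₑ ≤ ENNReal.ofReal (η₀ * (1 / √(q.2 : ℝ))) := not_lt.1 hn3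
      rw [← ofReal_norm, ENNReal.ofReal_le_ofReal_iff (by positivity)] at h1
      refine h1.trans (mul_le_of_le_one_right hη₀.le ?_)
      rw [div_le_one (by positivity)]
      exact hn1
    have hFX : ∀ t, ‖F q.2 ω (X t) - ∇ g (X t)‖ ≤ η₀ := fun t => by
      have h1 : ‖√(q.2 : ℝ) • (F q.2 ω (X t) - ∇ g (X t))‖ ≤ k :=
        UniformFun.norm_le_of_notMem_largeAlong hn2 t
      rw [norm_smul, Real.norm_of_nonneg (Real.sqrt_nonneg _)] at h1
      exact le_of_mul_le_mul_left (h1.trans hkn) (by linarith)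
    rw [mem_ofPred_eq] at hω
    refine absurd hω (not_lt.2 (iSup_le fun t => ?_))
    rw [← ofReal_norm]
    exact ENNReal.ofReal_le_ofReal (H (F q.2 ω) (x₀n q.2 ω) (Xn q.2 ω)
      ((hFlip q.2 ω).weaken hL') hFX hx' hgood.1 hgood.2 q.1 hδ.1 hδ.2 t)
  · set A : C(Icc (0 : ℝ) T, EuclideanSpace ℝ (Fin p) →L[ℝ] EuclideanSpace ℝ (Fin p)) :=
      ⟨fun t => hess g (X t), ((ContDiffOn.gradient_of_isOpen hΘ
        hrisk.contDiffOn).continuousOn_fderiv_of_isOpen hΘ le_rfl).comp_continuous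
          X.continuous hXΘ⟩ with hA
    obtain ⟨Φ, hΦ⟩ := a.exists_solution_operator hT.le A
    set z : Ω' → C(Icc (0 : ℝ) T, EuclideanSpace ℝ (Fin p)) := fun ω =>
      UniformFun.alongPath φ (restrictUniform ΘX (Z ω)) with hz
    -- Where `Z` is uniformly continuous on `ΘX`, its values along `X` form the continuous path `z
    -- ω`, and the problem is the linear equation solved by `Φ`.
    have hsolves : ∀ᵐ ω ∂P', ∀ v, a.Solves hT (fun t v => hess g (X t) v + Z ω (X t)) 0 v ↔
        ∀ t, v t = -DescentMethod.displacement a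
          (IccExtend hT.le (DescentMethod.pathApply A v + z ω)) t := by
      filter_upwards [hclt.ae_mem_of_isClosed hS hζ] with ω hω v
      rw [DescentMethod.solves_iff a hT
        (f := IccExtend hT.le (DescentMethod.pathApply A v + z ω))
        (DescentMethod.pathApply A v + z ω).continuous.Icc_extend' fun t => by
          rw [IccExtend_val]
          exact congrArg (hess g (X t) (v t) + ·) (UniformFun.alongPath_apply φ hω t)]
      simp only [zero_sub]
    refine ⟨fun ω => Φ (z ω), ?_, fun V' hV' => ?_, fun δ n hδ hn hnδ => ?_⟩
    · filter_upwards [hsolves] with ω hω using (hω _).2 (hΦ (z ω))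
    · filter_upwards [hsolves, hV'] with ω hω hV'ω
      exact a.eq_solution_operator_apply hT.le A ((hω _).1 hV'ω) (hΦ (z ω))
    refine (hclt.comp_tendsto hn).of_edist_map_tendsto_zero hS (fun j ω => hζ (n j) ω)
      (f := fun f => (Φ (UniformFun.alongPath φ f)).toSkorokhod)
      ((SkorokhodSpace.continuous_toSkorokhod.comp Φ.continuous).comp_continuousOn
        (UniformFun.continuousOn_alongPath φ))
      (UniformFun.measurable_comp_alongPath φ
        (SkorokhodSpace.continuous_toSkorokhod.comp Φ.continuous))
      (fun j => (SkorokhodSpace.measurable_stepError (fun k => a.measurable_iterate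
        (fun x hx => measurable_empGrad_comp (hUmeas (n j)) hΘ hloss.measurable
          hloss.contDiffOn hx) (δ j) (hx₀meas (n j)) k) _ _ X).aemeasurable) fun ε hε => ?_
    rw [ENNReal.tendsto_nhds_zero]
    intro e he
    -- The tolerance `e` may be infinite; a finite smaller one can be divided among the four events.
    obtain ⟨e', he'0, he'⟩ := ENNReal.lt_iff_exists_nnreal_btwn.1 he
    have he'pos : 0 < (e' : ℝ) := by exact_mod_cast he'0
    have he4 : 0 < ENNReal.ofReal ((e' : ℝ) / 4) := ENNReal.ofReal_pos.2 (by positivity)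
    obtain ⟨L, hL⟩ := exists_measure_empLipschitz_gt_le P hUmeas hUlaw hh₁int he4
    obtain ⟨k, hk⟩ := hclt.exists_eventually_measure_le hS hζ
      (UniformFun.isClosed_largeAlong φ) (UniformFun.antitone_largeAlong φ)
      (UniformFun.inter_iInter_largeAlong φ.continuous) he4
    -- The order of choices matters: `L` and `k` determine `κ`; asymptotic equicontinuity at level
    -- `κ` then gives the scale `ρ = 1 / (k' + 1)`, and only this determines the threshold `c₀` for
    -- `√n`.
    obtain ⟨κ, hκ, H⟩ := a.exists_iterate_expansion hT hΘXsub hgrad hX hXmem A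
      (fun κ hκ => exists_gradient_expansion hΘ hrisk.contDiffOn X hXΘ hκ) Φ hΦ L
      (Nat.cast_nonneg k) hε
    obtain ⟨k', hk'⟩ := hclt.exists_eventually_measure_le hS hζ
      (C := UniformFun.oscillating ΘX (EuclideanSpace ℝ (Fin p)) (ENNReal.ofReal κ))
      UniformFun.isClosed_oscillating UniformFun.antitone_oscillating
      (UniformFun.inter_iInter_oscillating (ENNReal.ofReal_pos.2 hκ) ENNReal.ofReal_ne_top) he4
    obtain ⟨c₀, H⟩ := H ((k' : ℝ) + 1)⁻¹ (by positivity)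
    filter_upwards [hn.eventually hk, hn.eventually hk',
      hn.eventually (ENNReal.tendsto_nhds_zero.1 (hx₀ κ hκ) _ he4),
      hn.eventually (hsqrt.eventually_ge_atTop c₀), hn.eventually (eventually_ge_atTop 1),
      hδ.eventually (Ioo_mem_nhdsGT one_pos),
      (tendsto_sqrt_mul_sqrt_zero hδ hnδ).eventually_le_const hκ]
      with j hj1 hj2 hj3 hj4 hj5 hj6 hj7
    refine le_trans ?_ he'.le
    rw [← ENNReal.ofReal_coe_nnreal]
    refine measure_le_of_subset_union he'pos.le ?_ (hL (n j)) hj1 hj2 hj3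
    intro ω hω
    by_contra hnot
    simp only [mem_union, not_or] at hnot
    obtain ⟨⟨hn1, hn2⟩, hn3, hn4⟩ := hnot
    have hL' : empLipschitz h₁ (fun i => U (n j) i ω) ≤ L := not_lt.1 hn1
    have hc : 0 < √(n j : ℝ) := Real.sqrt_pos.2 (by exact_mod_cast hj5)
    have hzt : ∀ t, UniformFun.alongPath φ (ζ (n j) ω) t
        = √(n j : ℝ) • (F (n j) ω (X t) - ∇ g (X t)) :=
      fun t => UniformFun.alongPath_apply φ (hζ (n j) ω) t
    have hfin := H √(n j : ℝ) (δ j) (F (n j) ω) (x₀n (n j) ω)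
      (UniformFun.alongPath φ (ζ (n j) ω)) hj4 hj6.1 hj6.2.le ((hFlip (n j) ω).weaken hL') hzt
      ((ContinuousMap.norm_le _ (Nat.cast_nonneg k)).2 fun t => by
        rw [hzt]
        exact UniformFun.norm_le_of_notMem_largeAlong hn2 t)
      (fun θ hθ ϑ hϑ hd => UniformFun.norm_sub_le_of_notMem_oscillating hκ.le hn3
        (x := ⟨θ, hθ⟩) (y := ⟨ϑ, hϑ⟩) (by rwa [Subtype.dist_eq, dist_eq_norm]))
      (by
        have h1 : ‖x₀n (n j) ω - x₀‖ₑ ≤ ENNReal.ofReal (κ * (1 / √(n j : ℝ))) := not_lt.1 hn4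
        rw [← ofReal_norm, ENNReal.ofReal_le_ofReal_iff (by positivity), mul_one_div,
          le_div_iff₀ hc] at h1
        linarith)
      hj7
    refine absurd hω (not_lt.2 ((SkorokhodSpace.edist_le_iSup _ _).trans (iSup_le fun t => ?_)))
    rw [edist_dist, dist_eq_norm]
    exact ENNReal.ofReal_le_ofReal (hfin t)
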